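/- **Setting.** Let $p\ge 1$, let $\Theta\subset\mathbb R^p$ be convex, and let $\{f(\cdot;\theta)\}_{\theta\in\Theta}$ be probability densities with respect to a common measure. Let $Z_1,Z_2,\dots$ be i.i.d. with density $f(\cdot;\theta_0)$, $\theta_0\in\Theta$. For almost every $z$, $f(z;\theta)>0$ and $\log f(z;\cdot)$ has derivatives up to order three on $\Theta$. Put $L_N(\theta)=N^{-1}\sum_{i=1}^N\log f(Z_i;\theta)$, let $S(z;\theta)=\partial\log f(z;\theta)/\partial\theta$ be the score, and for $j\ge 1$ let $H_j(z;\theta)$ be the array of all partial derivatives of order $j$ of the score (so $H_1$ is the Hessian of $\log f$); $S,H_j$ without argument are evaluated at $\theta_0$, and $\hat H_j(\theta)=N^{-1}\sum_{i=1}^N H_j(Z_i;\theta)$. $\|\cdot\|$ is the Euclidean/Frobenius norm. Let $\Lambda$ be a fixed $p\times p$ matrix with $\Lambda'\Lambda$ positive definite, $\theta_H\in\mathbb R^p$ fixed, $0\le\bar\lambda_N=O(N^{-1})$, and let $\mathcal L_N\subset[0,\bar\lambda_N]$ be non-empty and closed. For $\lambda\in[0,\bar\lambda_N]$ the generalized ridge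 estimator $\hat\theta_\lambda$ is a (measurable) maximizer over $\Theta$ of $L_N(\theta)-\lambda\|\Lambda(\theta-\theta_H)\|^2$, and $\hat\theta=\hat\theta_0$ is the maximum likelihood estimator (MLE); for all large $N$ these exist almost surely and satisfy $N^{-1}\sum_{i=1}^N S(Z_i;\hat\theta_\lambda)-2\lambda\Lambda'\Lambda(\hat\theta_\lambda-\theta_H)=0$. Also $E(S)=0$. Let $Q_\lambda=\{E(H_1)-2\lambda\Lambda'\Lambda\}^{-1}$, $Q=Q_0$, and let $$R(\lambda)=\operatorname{trace}E\{(\hat\theta_\lambda-\theta_0)(\hat\theta_\lambda-\theta_0)'\}$$ be the risk at a fixed $\lambda$. **Assumptions.** All orders are as $N\to\infty$, and $\lambda$ ranges over $[0,\bar\lambda_N]$. 1. $\hat\theta_\lambda-\theta_0=O_p(N^{-1/2})+O(\lambda)$, uniformly in $\lambda$. 2. In a neighborhood of $\theta_0$ contained in $\Theta$, $f(z;\theta)$ is thrice continuously differentiable in $\theta$ and $H_3$ exists, for almost every $z$; $E(S)$ and $E(H_j)$ are finite, $N^{-1}\sum_i S(Z_i;\theta_0)=O_p(N^{-1/2})$,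 and $\hat H_j(\theta_0)-E(H_j)=O_p(N^{-1/2})$, $j=1,2,3$. 3. For every $\theta$ in some neighborhood of $\theta_0$, $\{\hat H_1(\theta)\}^{-1}=O_p(1)$ and $\{\hat H_1(\theta)-2\lambda\Lambda'\Lambda\}^{-1}=O_p(1)$ uniformly in $\lambda$ (the inverses existing with probability tending to one); $Q$ and $Q_\lambda$ exist and are $O(1)$. 4. In a neighborhood of $\theta_0$, $\|H_j(Z_i;\theta)-H_j(Z_i;\theta_0)\|\le\|\theta-\theta_0\|M_i$ for $j=1,2,3$, where $M_i=M(Z_i)$ and $E|M_i|^8<\infty$. 5. $\hat\theta-\theta_0=O_p(N^{-1/2})$ and $\limsup_N E\|\sqrt N(\hat\theta-\theta_0)\|^{16}<\infty$. 6. $\sqrt N(\hat\theta-\theta_0)=-Q\,N^{-1/2}\sum_{i=1}^N S(Z_i;\theta_0)+o_p(1)$; $E(SS')=-E(H_1)$, and $E(SS')$ is positive definite. 7. $E\|H_1\|^4<\infty$ and $E\|S\|^8<\infty$. 8. There are $N_0$ and $C<\infty$ such that for all $N\ge N_0$: $\sup_{\theta\in\Theta}E\|\hat H_j(\theta)\|^{16}\le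 C$ for $j=1,2$, and, the inverses existing almost surely, $\sup_{\theta\in\Theta}\sup_{\lambda\in[0,\bar\lambda_N]}E\|\{\hat H_1(\theta)-2\lambda\Lambda'\Lambda\}^{-1}\|^{16}\le C$. **Selector.** With $\hat J=-\hat H_1(\hat\theta)$, $\hat A_\lambda=(\hat J+2\lambda\Lambda'\Lambda)^{-1}\hat J$, $\hat V=\hat J^{-1}/N$ and $\hat\delta_\lambda=\theta_H+\hat A_\lambda(\hat\theta-\theta_H)$, let $$\hat R(\lambda)=\|\hat\delta_\lambda-\hat\theta\|^2+2\operatorname{trace}(\hat V\hat A_\lambda)-\operatorname{trace}(\hat V),$$ and let $\hat\lambda\in\mathcal L_N$ minimize $\hat R$ over $\mathcal L_N$ (whenever the inverses in $\hat R$ exist for all $\lambda\in\mathcal L_N$). **Theorem.** Under these assumptions, for all large $N$ the risk $R(\lambda)$ is finite for all $\lambda\in\mathcal L_N$ and $\inf_{\lambda\in\mathcal L_N}R(\lambda)>0$, and, with $R(\hat\lambda)=R(\lambda)|_{\lambda=\hat\lambda}$, $$\frac{R(\hat\lambda)}{\inf_{\lambda\in\mathcal L_N}R(\lambda)}\xrightarrow{\;p\;}1\qquad(N\to\infty).$$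 -/

import Mathlib

open MeasureTheory ProbabilityTheory Filter Topology Set
open scoped ENNReal NNReal Matrix

noncomputable section

/-- Matrix-vector product on Euclidean space. -/
def matVec {p : ℕ} (A : Matrix (Fin p) (Fin p) ℝ) (x : EuclideanSpace ℝ (Fin p)) :
    EuclideanSpace ℝ (Fin p) :=
  WithLp.toLp 2 (A *ᵥ (WithLp.ofLp x))

/-- Frobenius norm of a matrix. -/
def frobNorm {p : ℕ} (A : Matrix (Fin p) (Fin p) ℝ) : ℝ :=
  √(∑ a, ∑ b, A a b ^ 2)

/-- The data of a penalised-likelihood problem: a sampling probability space `(Ω, P)`,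
a parametric family `f z θ` (density with respect to the reference measure `μ`) with parameter set
`Θ ⊆ ℝᵖ` and true value `θ₀`, observations `Z 0, Z 1, …` (the sample of size `N` is
`Z 0, …, Z (N-1)`), the weighting matrix, the shrinkage target, the ridge estimators
`est N lam` (`est N 0` is the MLE), the bounds `lamBar N`, and the candidate sets `cand N`. -/
structure RidgeModel (Ω 𝒵 : Type*) [MeasurableSpace Ω] [MeasurableSpace 𝒵] (p : ℕ) where
  P : Measure Ω
  μ : Measure 𝒵
  f : 𝒵 → EuclideanSpace ℝ (Fin p) → ℝ
  Θ : Set (EuclideanSpace ℝ (Fin p))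
  θ₀ : EuclideanSpace ℝ (Fin p)
  Z : ℕ → Ω → 𝒵
  weight : Matrix (Fin p) (Fin p) ℝ
  target : EuclideanSpace ℝ (Fin p)
  est : ℕ → ℝ → Ω → EuclideanSpace ℝ (Fin p)
  lamBar : ℕ → ℝ
  cand : ℕ → Set ℝ

namespace RidgeModel

variable {Ω 𝒵 : Type*} [MeasurableSpace Ω] [MeasurableSpace 𝒵] {p : ℕ} (M : RidgeModel Ω 𝒵 p)

/-- The true law of one observation. -/
def law : Measure 𝒵 := M.μ.withDensity (fun z => ENNReal.ofReal (M.f z M.θ₀))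

/-- Log-density of one observation, as a function of the parameter. -/
def logDens (z : 𝒵) (θ : EuclideanSpace ℝ (Fin p)) : ℝ := Real.log (M.f z θ)

/-- Average log-likelihood. -/
def logLik (N : ℕ) (ω : Ω) (θ : EuclideanSpace ℝ (Fin p)) : ℝ :=
  (N : ℝ)⁻¹ * ∑ i ∈ Finset.range N, M.logDens (M.Z i ω) θ

/-- `Λ'Λ`. -/
def gram : Matrix (Fin p) (Fin p) ℝ := M.weightᵀ * M.weight

/-- Penalised average log-likelihood. -/
def penLik (N : ℕ) (lam : ℝ) (ω : Ω) (θ : EuclideanSpace ℝ (Fin p)) : ℝ :=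
  M.logLik N ω θ - lam * ‖matVec M.weight (θ - M.target)‖ ^ 2

/-- Score of one observation. -/
def score (z : 𝒵) (θ : EuclideanSpace ℝ (Fin p)) : EuclideanSpace ℝ (Fin p) :=
  gradient (M.logDens z) θ

/-- The array `H_j` of all partial derivatives of order `j` of the score, that is, of order `j + 1`
of the log-density. Its Euclidean norm is the Frobenius norm of the array. -/
def H (j : ℕ) (z : 𝒵) (θ : EuclideanSpace ℝ (Fin p)) :
    EuclideanSpace ℝ (Fin (j + 1) → Fin p) :=
  WithLp.toLp 2 fun I =>
    iteratedFDeriv ℝ (j + 1) (M.logDens z) θ (fun a => EuclideanSpace.single (I a) (1 : ℝ))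

/-- The Hessian `H_1` of one observation as a matrix. -/
def hess (z : 𝒵) (θ : EuclideanSpace ℝ (Fin p)) : Matrix (Fin p) (Fin p) ℝ :=
  Matrix.of fun a b => M.H 1 z θ ![a, b]

def avgScore (N : ℕ) (ω : Ω) (θ : EuclideanSpace ℝ (Fin p)) : EuclideanSpace ℝ (Fin p) :=
  (N : ℝ)⁻¹ • ∑ i ∈ Finset.range N, M.score (M.Z i ω) θ

def avgH (j N : ℕ) (ω : Ω) (θ : EuclideanSpace ℝ (Fin p)) :
    EuclideanSpace ℝ (Fin (j + 1) → Fin p) :=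
  (N : ℝ)⁻¹ • ∑ i ∈ Finset.range N, M.H j (M.Z i ω) θ

def avgHess (N : ℕ) (ω : Ω) (θ : EuclideanSpace ℝ (Fin p)) : Matrix (Fin p) (Fin p) ℝ :=
  (N : ℝ)⁻¹ • ∑ i ∈ Finset.range N, M.hess (M.Z i ω) θ

/-- `E(H_1)` at the true value. -/
def meanHess : Matrix (Fin p) (Fin p) ℝ :=
  Matrix.of fun a b => ∫ z, M.hess z M.θ₀ a b ∂M.law

/-- `E(S S')` at the true value. -/
def scoreCov : Matrix (Fin p) (Fin p) ℝ :=
  Matrix.of fun a b => ∫ z, M.score z M.θ₀ a * M.score z M.θ₀ b ∂M.law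

/-- `Q_lam = (E(H_1) - 2 lam Λ'Λ)⁻¹`; `Q 0` is `E(H_1)⁻¹`. -/
def Q (lam : ℝ) : Matrix (Fin p) (Fin p) ℝ := (M.meanHess - (2 * lam) • M.gram)⁻¹

/-- The maximum likelihood estimator. -/
def mle (N : ℕ) (ω : Ω) : EuclideanSpace ℝ (Fin p) := M.est N 0 ω

/-- The matrix-valued mean squared error of the ridge estimator at a fixed `lam`. -/
def mse (N : ℕ) (lam : ℝ) : Matrix (Fin p) (Fin p) ℝ :=
  Matrix.of fun a b => ∫ ω, (M.est N lam ω - M.θ₀) a * (M.est N lam ω - M.θ₀) b ∂M.P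

/-- The risk `R(lam)`. -/
def risk (N : ℕ) (lam : ℝ) : ℝ := (M.mse N lam).trace

/-- `Ĵ` evaluated at the MLE. -/
def Jhat (N : ℕ) (ω : Ω) : Matrix (Fin p) (Fin p) ℝ := -M.avgHess N ω (M.mle N ω)

def Ahat (N : ℕ) (lam : ℝ) (ω : Ω) : Matrix (Fin p) (Fin p) ℝ :=
  (M.Jhat N ω + (2 * lam) • M.gram)⁻¹ * M.Jhat N ω

def Vhat (N : ℕ) (ω : Ω) : Matrix (Fin p) (Fin p) ℝ :=
  (N : ℝ)⁻¹ • (-(M.avgHess N ω (M.mle N ω))⁻¹)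

def deltaHat (N : ℕ) (lam : ℝ) (ω : Ω) : EuclideanSpace ℝ (Fin p) :=
  M.target + matVec (M.Ahat N lam ω) (M.mle N ω - M.target)

/-- The plug-in criterion `R̂(lam)` of Stein type. -/
def riskHat (N : ℕ) (lam : ℝ) (ω : Ω) : ℝ :=
  ‖M.deltaHat N lam ω - M.mle N ω‖ ^ 2
    + 2 * (M.Vhat N ω * M.Ahat N lam ω).trace - (M.Vhat N ω).trace

/-- All matrix inverses in the criterion exist, for every candidate `lam`. -/
def CriterionDefined (N : ℕ) (ω : Ω) : Prop :=
  IsUnit (M.Jhat N ω).det ∧ ∀ lam ∈ M.cand N, IsUnit (M.Jhat N ω + (2 * lam) • M.gram).det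

/-- `lamHat` takes values in the candidate set and minimises the criterion over it (whenever the
criterion is defined there). -/
def IsSelector (lamHat : ℕ → Ω → ℝ) : Prop :=
  ∀ᶠ N in atTop, ∀ᵐ ω ∂M.P, lamHat N ω ∈ M.cand N ∧
    (M.CriterionDefined N ω → ∀ lam ∈ M.cand N, M.riskHat N (lamHat N ω) ω ≤ M.riskHat N lam ω)

/-- The standing framework: i.i.d. sampling from the true density, a log-likelihood
that has derivatives up to order three on `Θ`, estimators that are maximisers and solve the
first-order conditions, compact candidate sets inside `[0, lamBar N]` with `lamBar N = O(1/N)`. -/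
structure Standing : Prop where
  prob : IsProbabilityMeasure M.P
  dens_meas : ∀ θ ∈ M.Θ, Measurable fun z => M.f z θ
  dens_nonneg : ∀ z, ∀ θ ∈ M.Θ, 0 ≤ M.f z θ
  dens_one : ∀ θ ∈ M.Θ, ∫⁻ z, ENNReal.ofReal (M.f z θ) ∂M.μ = 1
  true_mem : M.θ₀ ∈ M.Θ
  obs_meas : ∀ i, Measurable (M.Z i)
  obs_indep : iIndepFun M.Z M.P
  obs_law : ∀ i, M.P.map (M.Z i) = M.law
  gram_posDef : M.gram.PosDef
  logDens_diff : ∀ᵐ z ∂M.law, ∀ θ ∈ M.Θ, 0 < M.f z θ ∧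
    ∀ j < 3, DifferentiableAt ℝ (iteratedFDeriv ℝ j (M.logDens z)) θ
  score_mean : ∫ z, M.score z M.θ₀ ∂M.law = 0
  est_meas : ∀ N, ∀ lam ∈ Icc 0 (M.lamBar N), AEMeasurable (M.est N lam) M.P
  est_argmax : ∀ᶠ N in atTop, ∀ lam ∈ Icc 0 (M.lamBar N), ∀ᵐ ω ∂M.P,
    M.est N lam ω ∈ M.Θ ∧ ∀ θ ∈ M.Θ, M.penLik N lam ω θ ≤ M.penLik N lam ω (M.est N lam ω)
  est_foc : ∀ᶠ N in atTop, ∀ lam ∈ Icc 0 (M.lamBar N), ∀ᵐ ω ∂M.P,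
    M.avgScore N ω (M.est N lam ω) - (2 * lam) • matVec M.gram (M.est N lam ω - M.target) = 0
  lamBar_rate : M.lamBar =O[atTop] fun N : ℕ => (N : ℝ)⁻¹
  cand_nonempty : ∀ N, (M.cand N).Nonempty
  cand_closed : ∀ N, IsClosed (M.cand N)
  cand_subset : ∀ N, M.cand N ⊆ Icc 0 (M.lamBar N)

/-- `X_N = O_p(r_N)`. -/
def BigOp {E : Type*} [NormedAddCommGroup E] (X : ℕ → Ω → E) (r : ℕ → ℝ) : Prop :=
  ∀ ε > (0 : ℝ), ∃ K : ℝ, ∀ᶠ N in atTop,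
    M.P {ω | K * r N < ‖X N ω‖} ≤ ENNReal.ofReal ε

/-- `est N lam - θ₀ = O_p(N^{-1/2}) + O(lam)`, for `lam` in `[0, lamBar N]`. -/
def RidgeRate : Prop :=
  ∃ K' : ℝ, ∀ ε > (0 : ℝ), ∃ K : ℝ, ∀ᶠ N : ℕ in atTop, ∀ lam ∈ Icc 0 (M.lamBar N),
    M.P {ω | K * (√(N : ℝ))⁻¹ + K' * lam < ‖M.est N lam ω - M.θ₀‖} ≤ ENNReal.ofReal ε

/-- Smoothness of the density near `θ₀` (including existence of the derivatives in `H_3`), finite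
means of the score and of `H_1, H_2, H_3` at `θ₀`, and root-`N` rates for their sample means. -/
structure LocalRegularity : Prop where
  smooth : ∃ r > 0, Metric.ball M.θ₀ r ⊆ M.Θ ∧ ∀ᵐ z ∂M.law,
    ContDiffOn ℝ 3 (M.f z) (Metric.ball M.θ₀ r) ∧
    DifferentiableOn ℝ (iteratedFDeriv ℝ 3 (M.logDens z)) (Metric.ball M.θ₀ r)
  score_integrable : Integrable (fun z => M.score z M.θ₀) M.law
  score_rate : M.BigOp (fun N ω => M.avgScore N ω M.θ₀) (fun N => (√(N : ℝ))⁻¹)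
  H_integrable : ∀ j ∈ Icc 1 3, Integrable (fun z => M.H j z M.θ₀) M.law
  H_rate : ∀ j ∈ Icc 1 3,
    M.BigOp (fun N ω => M.avgH j N ω M.θ₀ - ∫ z, M.H j z M.θ₀ ∂M.law) (fun N => (√(N : ℝ))⁻¹)

/-- The inverses of the sample Hessian and of the penalised sample Hessian, in a neighbourhood
of `θ₀`, exist with probability tending to one and are `O_p(1)`; `Q` and `Q_lam` exist and are
`O(1)`. The case `lam = 0` is the unpenalised one. -/
structure InverseBounds : Prop where
  sample : ∃ r > 0, ∀ θ ∈ Metric.ball M.θ₀ r, ∀ ε > (0 : ℝ), ∃ K : ℝ, ∀ᶠ N in atTop,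
    ∀ lam ∈ Icc 0 (M.lamBar N),
      M.P {ω | ¬ (IsUnit (M.avgHess N ω θ - (2 * lam) • M.gram).det ∧
        frobNorm (M.avgHess N ω θ - (2 * lam) • M.gram)⁻¹ ≤ K)} ≤ ENNReal.ofReal ε
  population : ∃ K : ℝ, ∀ᶠ N in atTop, ∀ lam ∈ Icc 0 (M.lamBar N),
    IsUnit (M.meanHess - (2 * lam) • M.gram).det ∧ frobNorm (M.Q lam) ≤ K

/-- `H_1, H_2, H_3` are Lipschitz at `θ₀` in a neighbourhood, with a constant depending on the
observation that has a finite moment of order `r`. -/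
def LipschitzDerivatives (r : ℕ) : Prop :=
  ∃ ρ > 0, ∃ m : 𝒵 → ℝ, MemLp m r M.law ∧ ∀ᵐ z ∂M.law,
    ∀ θ ∈ Metric.ball M.θ₀ ρ, ∀ j ∈ Icc 1 3, ‖M.H j z θ - M.H j z M.θ₀‖ ≤ ‖θ - M.θ₀‖ * m z

/-- Root-`N` consistency of the MLE and boundedness of the `q`-th moment of the scaled error. -/
structure MLEMoments (q : ℕ) : Prop where
  rate : M.BigOp (fun N ω => M.mle N ω - M.θ₀) (fun N => (√(N : ℝ))⁻¹)
  moment : ∃ C : ℝ≥0,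
    limsup (fun N : ℕ => ∫⁻ ω, ‖√(N : ℝ) • (M.mle N ω - M.θ₀)‖ₑ ^ q ∂M.P) atTop ≤ (C : ℝ≥0∞)

/-- Asymptotic linearity of the MLE, information matrix equality, and positive definiteness. -/
structure MLERegularity : Prop where
  linear : TendstoInMeasure M.P
    (fun (N : ℕ) ω => √(N : ℝ) • (M.mle N ω - M.θ₀)
      + matVec (M.Q 0) ((√(N : ℝ))⁻¹ • ∑ i ∈ Finset.range N, M.score (M.Z i ω) M.θ₀))
    atTop (fun _ => 0)
  information : M.scoreCov = -M.meanHess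
  posDef : M.scoreCov.PosDef

/-- Fourth moment of the Hessian and `l`-th moment of the score at `θ₀`. -/
structure TrueValueMoments (l : ℕ) : Prop where
  hess : MemLp (fun z => M.H 1 z M.θ₀) 4 M.law
  score : MemLp (fun z => M.score z M.θ₀) l M.law

/-- Uniform bounds over `Θ` on the `k`-th moments of the sample means of `H_1, H_2` and of the
inverse of the (penalised) sample Hessian, which is almost surely invertible. -/
def UniformMoments (k : ℕ) : Prop :=
  ∃ N₀ : ℕ, ∃ C : ℝ≥0, ∀ N ≥ N₀, ∀ θ ∈ M.Θ,
    (∀ j ∈ Icc 1 2, ∫⁻ ω, ‖M.avgH j N ω θ‖ₑ ^ k ∂M.P ≤ C) ∧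
    ∀ lam ∈ Icc 0 (M.lamBar N),
      (∀ᵐ ω ∂M.P, IsUnit (M.avgHess N ω θ - (2 * lam) • M.gram).det) ∧
      ∫⁻ ω, ENNReal.ofReal (frobNorm (M.avgHess N ω θ - (2 * lam) • M.gram)⁻¹) ^ k ∂M.P ≤ C

end RidgeModel

end

/-! ### Quadratic forms, Frobenius norm and positive definiteness -/

section MatrixBounds

variable {p : ℕ}

/-! The penalty weight is `O(1/N)`, so the penalty moves the estimator by only `O(1/N)`, whereas the
error of the MLE is of order `N^{-1/2}`. Hence every risk over `[0, lamBar N]` equals the risk of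
the MLE up to `O(N^{-3/2})`, uniformly, while the risk of the MLE is at least a constant over `N`.
The ratio of the risk at any candidate to the smallest risk therefore tends to one uniformly over
the candidate set, so it does so at whichever candidate is selected.

Closeness to the MLE (`Standing.exists_close_event`) rests on concavity of the log-likelihood. Near
`θ₀` it is strongly concave off an event of probability `O(N⁻²)`, by fourth-moment deviation bounds
and the Lipschitz condition. Far from `θ₀` only moments of the inverse Hessian at fixed parameters
are known, but these suffice: a differentiable path of matrices that hits a singular one has huge
inverses at nearby grid points, which Markov's inequality makes improbable (`ae_forall_isUnit_det`).
So the Hessian is almost surely nonsingular along whole segments, its signature cannot change, and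
concavity spreads from `θ₀` to the interior of `Θ`. Monotonicity of the score combined with the two
first-order conditions then bounds the distance between the estimators
(`inner_sub_le_of_hasFDerivAt`).

On the exceptional event, comparing the two maximisation problems still bounds the ridge error
linearly by the MLE error (`Standing.exists_norm_est_sub_le`), and probability `O(N⁻²)` together
with fourth moments makes the contribution to the risk negligible (`abs_integral_sq_sub_le`). The
lower bound on the MLE risk (`Standing.exists_le_integral_sq`) comes from asymptotic linearity, with
fourth moments of the score preventing its variance from hiding in the event where the linearisation
fails. -/

lemma inner_eq_sum_mul (x y : EuclideanSpace ℝ (Fin p)) : inner ℝ x y = ∑ a, x a * y a := by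
  simp [PiLp.inner_apply, mul_comm]

lemma matVec_apply (A : Matrix (Fin p) (Fin p) ℝ) (x : EuclideanSpace ℝ (Fin p)) (a : Fin p) :
    matVec A x a = ∑ b, A a b * x b := by
  simp [matVec, Matrix.mulVec, dotProduct]

lemma inner_matVec (A : Matrix (Fin p) (Fin p) ℝ) (x y : EuclideanSpace ℝ (Fin p)) :
    inner ℝ x (matVec A y) = ∑ a, ∑ b, x a * A a b * y b := by
  simp [inner_eq_sum_mul, matVec_apply, Finset.mul_sum, mul_assoc]

lemma matVec_sub (A B : Matrix (Fin p) (Fin p) ℝ) (x : EuclideanSpace ℝ (Fin p)) :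
    matVec (A - B) x = matVec A x - matVec B x := by
  ext a; simp [matVec_apply, sub_mul]

lemma matVec_neg (A : Matrix (Fin p) (Fin p) ℝ) (x : EuclideanSpace ℝ (Fin p)) :
    matVec (-A) x = -matVec A x := by
  ext a; simp [matVec_apply]

lemma matVec_smul_right (A : Matrix (Fin p) (Fin p) ℝ) (c : ℝ) (x : EuclideanSpace ℝ (Fin p)) :
    matVec A (c • x) = c • matVec A x := by
  ext a; simp [matVec_apply, Finset.mul_sum, mul_left_comm]

lemma matVec_mul (A B : Matrix (Fin p) (Fin p) ℝ) (x : EuclideanSpace ℝ (Fin p)) :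
    matVec (A * B) x = matVec A (matVec B x) := by
  simp [matVec, Matrix.mulVec_mulVec]

lemma matVec_one (x : EuclideanSpace ℝ (Fin p)) : matVec 1 x = x := by
  simp [matVec]

lemma frobNorm_nonneg (A : Matrix (Fin p) (Fin p) ℝ) : 0 ≤ frobNorm A := Real.sqrt_nonneg _

lemma norm_matVec_le (A : Matrix (Fin p) (Fin p) ℝ) (x : EuclideanSpace ℝ (Fin p)) :
    ‖matVec A x‖ ≤ frobNorm A * ‖x‖ := by
  rw [EuclideanSpace.norm_eq, EuclideanSpace.norm_eq, frobNorm, ← Real.sqrt_mul (by positivity)]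
  apply Real.sqrt_le_sqrt
  rw [Finset.sum_mul]
  refine Finset.sum_le_sum fun a _ => ?_
  rw [matVec_apply, Real.norm_eq_abs, sq_abs]
  simpa using Finset.sum_mul_sq_le_sq_mul_sq Finset.univ (fun b => A a b) (fun b => x b)

lemma abs_inner_matVec_le (A : Matrix (Fin p) (Fin p) ℝ) (x : EuclideanSpace ℝ (Fin p)) :
    |inner ℝ x (matVec A x)| ≤ frobNorm A * ‖x‖ ^ 2 := by
  refine (abs_real_inner_le_norm _ _).trans ?_
  nlinarith [norm_matVec_le A x, norm_nonneg x]

lemma frobNorm_le_of_forall_abs_le {A : Matrix (Fin p) (Fin p) ℝ} {ε : ℝ} (hε : 0 ≤ ε)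
    (h : ∀ a b, |A a b| ≤ ε) : frobNorm A ≤ p * ε := by
  rw [frobNorm, Real.sqrt_le_left (by positivity)]
  calc ∑ a, ∑ b, A a b ^ 2 ≤ ∑ _a : Fin p, ∑ _b : Fin p, ε ^ 2 := by
        refine Finset.sum_le_sum fun a _ => Finset.sum_le_sum fun b _ => ?_
        exact sq_le_sq' (abs_le.1 (h a b)).1 (abs_le.1 (h a b)).2
    _ = (p * ε) ^ 2 := by simp; ring

lemma continuous_frobNorm : Continuous (frobNorm (p := p)) := by
  unfold frobNorm
  fun_prop

lemma frobNorm_zero : frobNorm (0 : Matrix (Fin p) (Fin p) ℝ) = 0 := by simp [frobNorm]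

lemma posDef_of_isSymm {A : Matrix (Fin p) (Fin p) ℝ} (hA : A.IsSymm)
    (h : ∀ x : EuclideanSpace ℝ (Fin p), x ≠ 0 → 0 < inner ℝ x (matVec A x)) : A.PosDef := by
  refine Matrix.PosDef.of_dotProduct_mulVec_pos (by simpa [Matrix.IsHermitian] using hA.eq)
    fun x hx => ?_
  have := h (WithLp.toLp 2 x) (by simpa using hx)
  simpa [inner_eq_sum_mul, matVec, dotProduct] using this

lemma posSemidef_of_isSymm {A : Matrix (Fin p) (Fin p) ℝ} (hA : A.IsSymm)
    (h : ∀ x : EuclideanSpace ℝ (Fin p), 0 ≤ inner ℝ x (matVec A x)) : A.PosSemidef := by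
  refine Matrix.PosSemidef.of_dotProduct_mulVec_nonneg (by simpa [Matrix.IsHermitian] using hA.eq)
    fun x => ?_
  have := h (WithLp.toLp 2 x)
  simpa [inner_eq_sum_mul, matVec, dotProduct] using this

lemma inner_matVec_pos {A : Matrix (Fin p) (Fin p) ℝ} (hA : A.PosDef)
    {x : EuclideanSpace ℝ (Fin p)} (hx : x ≠ 0) : 0 < inner ℝ x (matVec A x) := by
  have := hA.dotProduct_mulVec_pos (x := WithLp.ofLp x) (by simpa using hx)
  simpa [inner_eq_sum_mul, matVec, dotProduct] using this

/-- A positive definite form is bounded below by a multiple of the squared norm. -/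
lemma exists_le_inner_matVec {A : Matrix (Fin p) (Fin p) ℝ} (hA : A.PosDef) :
    ∃ c > 0, ∀ x : EuclideanSpace ℝ (Fin p), c * ‖x‖ ^ 2 ≤ inner ℝ x (matVec A x) := by
  by_cases hne : (Metric.sphere (0 : EuclideanSpace ℝ (Fin p)) 1).Nonempty
  · have hcont : Continuous fun x : EuclideanSpace ℝ (Fin p) => inner ℝ x (matVec A x) := by
      simp only [inner_matVec]; fun_prop
    obtain ⟨x₀, hx₀, hmin⟩ := (isCompact_sphere (0 : EuclideanSpace ℝ (Fin p)) 1).exists_isMinOn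
      hne hcont.continuousOn
    have hx₀' : x₀ ≠ 0 := by rintro rfl; simp at hx₀
    refine ⟨_, inner_matVec_pos hA hx₀', fun x => ?_⟩
    by_cases hx : x = 0
    · simp [hx]
    have hnx : ‖x‖ ≠ 0 := norm_ne_zero_iff.2 hx
    have h1 : ‖x‖⁻¹ • x ∈ Metric.sphere (0 : EuclideanSpace ℝ (Fin p)) 1 := by
      simp [norm_smul, hnx]
    have h2 := hmin h1
    simp only [mem_ofPred_eq, matVec_smul_right, inner_smul_left, inner_smul_right] at h2
    calc _ ≤ (‖x‖⁻¹ * (‖x‖⁻¹ * inner ℝ x (matVec A x))) * ‖x‖ ^ 2 := by gcongr; simpa using h2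
      _ = _ := by field_simp
  -- An empty unit sphere means dimension zero, where any constant serves.
  · refine ⟨1, one_pos, fun x => ?_⟩
    have hx : x = 0 := by
      by_contra hx
      exact hne ⟨‖x‖⁻¹ • x, by simp [norm_smul, norm_ne_zero_iff.2 hx]⟩
    simp [hx]

lemma exists_matVec_eq_zero {A : Matrix (Fin p) (Fin p) ℝ} (hA : ¬ IsUnit A.det) :
    ∃ x : EuclideanSpace ℝ (Fin p), x ≠ 0 ∧ matVec A x = 0 := by
  obtain ⟨v, hv, h⟩ := Matrix.exists_mulVec_eq_zero_iff.2 (by simpa using hA : A.det = 0)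
  exact ⟨WithLp.toLp 2 v, by simpa using hv, by simp [matVec, h]⟩

/-- The inverse of a matrix close to a singular matrix is large. -/
lemma one_le_frobNorm_inv_mul {A B : Matrix (Fin p) (Fin p) ℝ} (hA : ¬ IsUnit A.det)
    (hB : IsUnit B.det) : 1 ≤ frobNorm B⁻¹ * frobNorm (B - A) := by
  -- A kernel vector `x` of `A` satisfies `x = B⁻¹ (B - A) x`; comparing norms gives the bound.
  obtain ⟨x, hx, hAx⟩ := exists_matVec_eq_zero hA
  have h1 : x = matVec B⁻¹ (matVec (B - A) x) := by
    rw [matVec_sub, hAx, sub_zero, ← matVec_mul, Matrix.nonsing_inv_mul _ hB, matVec_one]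
  have h2 : ‖x‖ ≤ frobNorm B⁻¹ * (frobNorm (B - A) * ‖x‖) := by
    conv_lhs => rw [h1]
    exact (norm_matVec_le _ _).trans (by gcongr; exacts [frobNorm_nonneg _, norm_matVec_le _ _])
  have h3 : 0 < ‖x‖ := norm_pos_iff.2 hx
  by_contra! h
  nlinarith

/-- Along a continuous path of invertible symmetric matrices positive definiteness persists. -/
lemma posDef_of_path {T : Type*} [TopologicalSpace T] [PreconnectedSpace T]
    {A : T → Matrix (Fin p) (Fin p) ℝ} (hcont : Continuous A) (hsymm : ∀ t, (A t).IsSymm)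
    (hdet : ∀ t, IsUnit (A t).det) {s : T} (hs : (A s).PosDef) (t : T) : (A t).PosDef := by
  -- Given invertibility, positive definite and positive semidefinite coincide, and the latter is an
  -- intersection of closed conditions.
  have hset : {t | (A t).PosDef} =
      ⋂ x : EuclideanSpace ℝ (Fin p), {t | 0 ≤ inner ℝ x (matVec (A t) x)} := by
    ext t
    simp only [mem_ofPred_eq, mem_iInter]
    refine ⟨fun h x => ?_, fun h => ?_⟩
    · by_cases hx : x = 0
      · simp [hx]
      · exact (inner_matVec_pos h hx).le
    · exact (posSemidef_of_isSymm (hsymm t) h).posDef_iff_det_ne_zero.2 (hdet t).ne_zero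
  have hclosed : IsClosed {t | (A t).PosDef} := by
    rw [hset]
    refine isClosed_iInter fun x => isClosed_le continuous_const ?_
    simp only [inner_matVec]
    fun_prop
  -- A perturbation with Frobenius norm below the coercivity constant keeps the form positive.
  have hopen : IsOpen {t | (A t).PosDef} := by
    rw [isOpen_iff_mem_nhds]
    intro t ht
    obtain ⟨c, hc, hbound⟩ := exists_le_inner_matVec ht
    have hlim : Tendsto (fun u => frobNorm (A u - A t)) (𝓝 t) (𝓝 0) := by
      have : Continuous fun u => frobNorm (A u - A t) :=
        continuous_frobNorm.comp (hcont.sub continuous_const)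
      simpa [frobNorm_zero] using this.tendsto t
    filter_upwards [hlim.eventually (gt_mem_nhds hc)] with u hu
    refine posDef_of_isSymm (hsymm u) fun x hx => ?_
    have h1 := abs_inner_matVec_le (A u - A t) x
    rw [matVec_sub, inner_sub_right] at h1
    have h2 := (abs_le.1 h1).1
    have h3 : 0 < ‖x‖ ^ 2 := by positivity
    nlinarith [hbound x]
  have := IsClopen.eq_univ ⟨hclosed, hopen⟩ ⟨s, hs⟩
  exact (this ▸ mem_univ t : t ∈ {t | (A t).PosDef})

end MatrixBounds

/-! ### Monotonicity of the gradient of a concave function -/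

section Concavity

/-- Strong monotonicity of minus a gradient field: if its derivative is negative semidefinite on the
interior of a convex set and uniformly negative definite on a ball, the field is monotone with an
explicit modulus from points well inside the ball. -/
lemma inner_sub_le_of_hasFDerivAt {E : Type*} [NormedAddCommGroup E] [InnerProductSpace ℝ E]
    {Θ : Set E} (hΘ : Convex ℝ Θ) {θ₀ x y : E} {r c : ℝ} (hr : 0 < r)
    (hball : Metric.ball θ₀ r ⊆ Θ) (hx : x ∈ Metric.ball θ₀ (r / 2)) (hy : y ∈ Θ) {g : E → E}
    {g' : E → E →L[ℝ] E} (hg : ∀ θ ∈ Θ, HasFDerivAt g (g' θ) θ)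
    (hint : ∀ θ ∈ interior Θ, ∀ v, inner ℝ (g' θ v) v ≤ 0)
    (hneg : ∀ θ ∈ Metric.ball θ₀ r, ∀ v, inner ℝ (g' θ v) v ≤ -(c * ‖v‖ ^ 2)) :
    inner ℝ (g y - g x) (y - x) ≤ -(c * (‖y - x‖ * min ‖y - x‖ (r / 2))) := by
  by_cases hxy : y = x
  · simp [hxy]
  set d := y - x with hd
  have hdpos : 0 < ‖d‖ := norm_pos_iff.2 (sub_ne_zero.2 hxy)
  have hxr : x ∈ Metric.ball θ₀ r := Metric.ball_subset_ball (by linarith) hx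
  have hxint : x ∈ interior Θ := interior_maximal hball Metric.isOpen_ball hxr
  have hline : ∀ t : ℝ, x + t • d = (1 - t) • x + t • y := fun t => by rw [hd]; module
  have hmem : ∀ t ∈ Icc (0 : ℝ) 1, x + t • d ∈ Θ := fun t ht => by
    rw [hline]
    exact hΘ (hball hxr) hy (by linarith [ht.2]) ht.1 (by ring)
  -- The endpoint `y` may lie on the boundary of `Θ`, but the open segment from an interior point
  -- does not, so the sign condition on the interior is enough.
  have hmem_int : ∀ t ∈ Ioo (0 : ℝ) 1, x + t • d ∈ interior Θ := fun t ht => by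
    rw [hline]
    exact hΘ.openSegment_interior_self_subset_interior hxint hy
      ⟨1 - t, t, by linarith [ht.2], ht.1, by ring, rfl⟩
  set φ : ℝ → ℝ := fun t => inner ℝ (g (x + t • d)) d with hφ
  have hderiv : ∀ t ∈ Icc (0 : ℝ) 1, HasDerivAt φ (inner ℝ (g' (x + t • d) d) d) t := by
    intro t ht
    have h1 : HasDerivAt (fun t : ℝ => x + t • d) d t := by
      simpa using ((hasDerivAt_id t).smul_const d).const_add x
    have h2 := (hg _ (hmem t ht)).comp_hasDerivAt t h1
    simpa using h2.inner ℝ (hasDerivAt_const t d)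
  -- At time `t₁` the segment has covered the distance `min ‖d‖ (r / 2)`; having started in the
  -- half-radius ball, it is still in the ball of radius `r` before that time. Strong concavity is
  -- used up to `t₁` and plain concavity afterwards.
  set t₁ : ℝ := min 1 (r / (2 * ‖d‖)) with ht₁
  have ht₁0 : 0 < t₁ := by positivity
  have ht₁1 : t₁ ≤ 1 := min_le_left _ _
  have hprod : ‖d‖ * t₁ = min ‖d‖ (r / 2) := by
    rw [ht₁, mul_min_of_nonneg _ _ hdpos.le]
    congr 1
    · ring
    · field_simp
  have hmean : ∀ a b C : ℝ, 0 ≤ a → a ≤ b → b ≤ 1 →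
      (∀ t ∈ Ioo a b, inner ℝ (g' (x + t • d) d) d ≤ C) → φ b - φ a ≤ C * (b - a) := by
    intro a b C ha hab hb h
    have hsub : ∀ t ∈ Icc a b, t ∈ Icc (0 : ℝ) 1 := fun t ht => ⟨ha.trans ht.1, ht.2.trans hb⟩
    refine (convex_Icc a b).image_sub_le_mul_sub_of_deriv_le
      (fun t ht => (hderiv t (hsub t ht)).continuousAt.continuousWithinAt)
      (fun t ht => (hderiv t (hsub t (interior_subset ht))).differentiableAt.differentiableWithinAt)
      (fun t ht => ?_) a (left_mem_Icc.2 hab) b (right_mem_Icc.2 hab) hab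
    rw [(hderiv t (hsub t (interior_subset ht))).deriv]
    exact h t (by rwa [interior_Icc] at ht)
  have h1 : φ t₁ - φ 0 ≤ -(c * ‖d‖ ^ 2) * (t₁ - 0) := by
    refine hmean 0 t₁ _ le_rfl ht₁0.le ht₁1 fun t ht => hneg _ ?_ d
    rw [Metric.mem_ball, dist_eq_norm] at hx ⊢
    calc ‖x + t • d - θ₀‖ = ‖(x - θ₀) + t • d‖ := by congr 1; abel
      _ ≤ ‖x - θ₀‖ + t * ‖d‖ := by
        refine (norm_add_le _ _).trans ?_
        rw [norm_smul, Real.norm_of_nonneg ht.1.le]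
      _ < r / 2 + ‖d‖ * t₁ := by nlinarith [ht.2]
      _ ≤ r := by rw [hprod]; linarith [min_le_right ‖d‖ (r / 2)]
  have h2 : φ 1 - φ t₁ ≤ 0 * (1 - t₁) :=
    hmean t₁ 1 0 ht₁0.le ht₁1 le_rfl fun t ht =>
      hint _ (hmem_int t ⟨ht₁0.trans ht.1, ht.2⟩) d
  have h3 : φ 1 - φ 0 = inner ℝ (g y - g x) d := by
    simp [hφ, hd, inner_sub_left]
  rw [← h3, ← hprod]
  nlinarith

end Concavity

/-! ### Iterated derivatives, gradient and Hessian -/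

section Derivatives

variable {p : ℕ}

lemma differentiableAt_of_iteratedFDeriv_zero {E : Type*} [NormedAddCommGroup E] [NormedSpace ℝ E]
    {f : E → ℝ} {x : E} (h : DifferentiableAt ℝ (iteratedFDeriv ℝ 0 f) x) :
    DifferentiableAt ℝ f x := by
  rw [iteratedFDeriv_zero_eq_comp] at h
  exact (LinearIsometryEquiv.comp_differentiableAt_iff _).1 h

/-- The derivative is a finite combination of coordinate projections, with coefficients obtained by
evaluating the first iterated derivative on basis vectors. -/
lemma differentiableAt_fderiv_of_iteratedFDeriv_one {f : EuclideanSpace ℝ (Fin p) → ℝ}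
    {x : EuclideanSpace ℝ (Fin p)} (h : DifferentiableAt ℝ (iteratedFDeriv ℝ 1 f) x) :
    DifferentiableAt ℝ (fderiv ℝ f) x := by
  have hsum : fderiv ℝ f = fun y => ∑ a, iteratedFDeriv ℝ 1 f y
      (fun _ => EuclideanSpace.single a (1 : ℝ)) • EuclideanSpace.proj (𝕜 := ℝ) a := by
    ext y v
    have hv : v = ∑ a, v a • EuclideanSpace.single a (1 : ℝ) := by
      ext b
      simp [Finset.sum_apply, Pi.single_apply]
    conv_lhs => rw [hv]
    simp [iteratedFDeriv_one_apply, mul_comm]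
  rw [hsum]
  exact DifferentiableAt.fun_sum fun a _ =>
    (h.continuousMultilinear_apply_const _).smul_const _

lemma gradient_apply (f : EuclideanSpace ℝ (Fin p) → ℝ) (x : EuclideanSpace ℝ (Fin p))
    (a : Fin p) : gradient f x a = fderiv ℝ f x (EuclideanSpace.single a 1) := by
  rw [← inner_gradient_left, EuclideanSpace.inner_single_right]
  simp

lemma differentiableAt_gradient {f : EuclideanSpace ℝ (Fin p) → ℝ} {x : EuclideanSpace ℝ (Fin p)}
    (h : DifferentiableAt ℝ (fderiv ℝ f) x) : DifferentiableAt ℝ (gradient f) x := by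
  rw [differentiableAt_euclidean]
  intro a
  simp only [gradient_apply]
  exact h.clm_apply (differentiableAt_const _)

/-- Links the derivative of the score, which governs monotonicity, to the second derivative that
defines the Hessian array. -/
lemma inner_fderiv_gradient {f : EuclideanSpace ℝ (Fin p) → ℝ} {x : EuclideanSpace ℝ (Fin p)}
    (h : DifferentiableAt ℝ (fderiv ℝ f) x) (v w : EuclideanSpace ℝ (Fin p)) :
    inner ℝ (fderiv ℝ (gradient f) x v) w = fderiv ℝ (fderiv ℝ f) x v w := by
  have h1 : HasFDerivAt (fun y => inner ℝ (gradient f y) w)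
      ((innerSL ℝ w).comp (fderiv ℝ (gradient f) x)) x := by
    simp_rw [real_inner_comm w]
    exact (innerSL ℝ w).hasFDerivAt.comp x (differentiableAt_gradient h).hasFDerivAt
  simp_rw [inner_gradient_left] at h1
  have h2 := h1.unique (h.hasFDerivAt.clm_apply (hasFDerivAt_const w x))
  have h3 := congrArg (fun L => L v) h2
  simpa [real_inner_comm] using h3

end Derivatives

/-! ### Differentiability of the sample score and the sample Hessian -/

namespace RidgeModel

variable {Ω 𝒵 : Type*} [MeasurableSpace Ω] [MeasurableSpace 𝒵] {p : ℕ} (M : RidgeModel Ω 𝒵 p)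

/-- The log-density of `z` is three times differentiable on the parameter set. -/
def SmoothAt (z : 𝒵) : Prop :=
  ∀ θ ∈ M.Θ, ∀ j < 3, DifferentiableAt ℝ (iteratedFDeriv ℝ j (M.logDens z)) θ

variable {M}

lemma SmoothAt.differentiableAt {z : 𝒵} (h : M.SmoothAt z) {θ : EuclideanSpace ℝ (Fin p)}
    (hθ : θ ∈ M.Θ) : DifferentiableAt ℝ (M.logDens z) θ :=
  differentiableAt_of_iteratedFDeriv_zero (h θ hθ 0 (by norm_num))

lemma SmoothAt.differentiableAt_fderiv {z : 𝒵} (h : M.SmoothAt z) {θ : EuclideanSpace ℝ (Fin p)}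
    (hθ : θ ∈ M.Θ) : DifferentiableAt ℝ (fderiv ℝ (M.logDens z)) θ :=
  differentiableAt_fderiv_of_iteratedFDeriv_one (h θ hθ 1 (by norm_num))

lemma hess_apply (z : 𝒵) (θ : EuclideanSpace ℝ (Fin p)) (a b : Fin p) :
    M.hess z θ a b = fderiv ℝ (fderiv ℝ (M.logDens z)) θ (EuclideanSpace.single a 1)
      (EuclideanSpace.single b 1) := by
  simp [hess, H, iteratedFDeriv_two_apply]

lemma SmoothAt.differentiableAt_hess {z : 𝒵} (h : M.SmoothAt z) {θ : EuclideanSpace ℝ (Fin p)}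
    (hθ : θ ∈ M.Θ) (a b : Fin p) : DifferentiableAt ℝ (fun θ => M.hess z θ a b) θ := by
  simp only [hess, H, Matrix.of_apply]
  exact (h θ hθ 2 (by norm_num)).continuousMultilinear_apply_const _

/-- Equality of mixed partials needs differentiability in a whole neighbourhood, hence the
restriction to the interior of `Θ`. -/
lemma SmoothAt.hess_symm {z : 𝒵} (h : M.SmoothAt z) {θ : EuclideanSpace ℝ (Fin p)}
    (hθ : θ ∈ interior M.Θ) (a b : Fin p) : M.hess z θ a b = M.hess z θ b a := by
  rw [hess_apply, hess_apply]
  refine second_derivative_symmetric_of_eventually (f := M.logDens z) (x := θ) ?_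
    (h.differentiableAt_fderiv (interior_subset hθ)).hasFDerivAt _ _
  filter_upwards [mem_interior_iff_mem_nhds.1 hθ] with y hy using (h.differentiableAt hy).hasFDerivAt

lemma fderiv_fderiv_eq_inner (z : 𝒵) (θ v w : EuclideanSpace ℝ (Fin p)) :
    fderiv ℝ (fderiv ℝ (M.logDens z)) θ v w = inner ℝ v (matVec (M.hess z θ) w) := by
  have hv : ∀ v : EuclideanSpace ℝ (Fin p), v = ∑ a, v a • EuclideanSpace.single a (1 : ℝ) := by
    intro v
    ext b
    simp [Finset.sum_apply, Pi.single_apply]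
  conv_lhs => rw [hv v, hv w]
  simp only [map_sum, map_smul, _root_.sum_apply, _root_.smul_apply,
    smul_eq_mul, inner_matVec, hess_apply, Finset.mul_sum]
  rw [Finset.sum_comm]
  refine Finset.sum_congr rfl fun a _ => Finset.sum_congr rfl fun b _ => by ring

lemma avgHess_apply (N : ℕ) (ω : Ω) (θ : EuclideanSpace ℝ (Fin p)) (a b : Fin p) :
    M.avgHess N ω θ a b = (N : ℝ)⁻¹ * ∑ i ∈ Finset.range N, M.hess (M.Z i ω) θ a b := by
  simp [avgHess, Matrix.sum_apply]

lemma inner_matVec_avgHess (N : ℕ) (ω : Ω) (θ v w : EuclideanSpace ℝ (Fin p)) :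
    inner ℝ v (matVec (M.avgHess N ω θ) w) =
      (N : ℝ)⁻¹ * ∑ i ∈ Finset.range N, inner ℝ v (matVec (M.hess (M.Z i ω) θ) w) := by
  simp only [inner_matVec, avgHess_apply, Finset.mul_sum, Finset.sum_mul]
  rw [Finset.sum_comm' (t' := Finset.univ) (s' := fun _ => Finset.range N) (by simp)]
  refine Finset.sum_congr rfl fun a _ => ?_
  rw [Finset.sum_comm]
  refine Finset.sum_congr rfl fun i _ => Finset.sum_congr rfl fun b _ => by ring

lemma hasFDerivAt_avgScore {ω : Ω} (h : ∀ i, M.SmoothAt (M.Z i ω)) (N : ℕ)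
    {θ : EuclideanSpace ℝ (Fin p)} (hθ : θ ∈ M.Θ) :
    HasFDerivAt (M.avgScore N ω) (fderiv ℝ (M.avgScore N ω) θ) θ ∧
      ∀ v w, inner ℝ (fderiv ℝ (M.avgScore N ω) θ v) w =
        inner ℝ v (matVec (M.avgHess N ω θ) w) := by
  have h1 : HasFDerivAt (M.avgScore N ω)
      ((N : ℝ)⁻¹ • ∑ i ∈ Finset.range N, fderiv ℝ (gradient (M.logDens (M.Z i ω))) θ) θ := by
    unfold avgScore score
    have h2 : HasFDerivAt (fun θ => ∑ i ∈ Finset.range N, gradient (M.logDens (M.Z i ω)) θ)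
        (∑ i ∈ Finset.range N, fderiv ℝ (gradient (M.logDens (M.Z i ω))) θ) θ :=
      HasFDerivAt.fun_sum fun i _ => (differentiableAt_gradient
        ((h i).differentiableAt_fderiv hθ)).hasFDerivAt
    exact h2.const_smul (N : ℝ)⁻¹
  rw [h1.fderiv]
  refine ⟨h1, fun v w => ?_⟩
  simp only [_root_.smul_apply, _root_.sum_apply, inner_smul_left,
    sum_inner, inner_matVec_avgHess]
  congr 1
  refine Finset.sum_congr rfl fun i _ => ?_
  rw [inner_fderiv_gradient ((h i).differentiableAt_fderiv hθ), fderiv_fderiv_eq_inner]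

lemma differentiableAt_avgHess {ω : Ω} (h : ∀ i, M.SmoothAt (M.Z i ω)) (N : ℕ)
    {θ : EuclideanSpace ℝ (Fin p)} (hθ : θ ∈ M.Θ) (a b : Fin p) :
    DifferentiableAt ℝ (fun θ => M.avgHess N ω θ a b) θ := by
  simp only [avgHess_apply]
  exact (DifferentiableAt.fun_sum fun i _ => (h i).differentiableAt_hess hθ a b).const_mul _

lemma continuousAt_avgHess {ω : Ω} (h : ∀ i, M.SmoothAt (M.Z i ω)) (N : ℕ)
    {θ : EuclideanSpace ℝ (Fin p)} (hθ : θ ∈ M.Θ) : ContinuousAt (M.avgHess N ω) θ :=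
  continuousAt_pi.2 fun a => continuousAt_pi.2 fun b =>
    (differentiableAt_avgHess h N hθ a b).continuousAt

lemma isSymm_avgHess {ω : Ω} (h : ∀ i, M.SmoothAt (M.Z i ω)) (N : ℕ)
    {θ : EuclideanSpace ℝ (Fin p)} (hθ : θ ∈ interior M.Θ) : (M.avgHess N ω θ).IsSymm := by
  refine Matrix.IsSymm.ext fun a b => ?_
  simp only [avgHess_apply, (h _).hess_symm hθ a b]

end RidgeModel

/-! ### Random matrix paths that avoid singular matrices -/

section Nonsingularity

variable {Ω : Type*} [MeasurableSpace Ω] {p : ℕ}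

/-- The inverse is the adjugate times the reciprocal of the determinant, with the convention `0⁻¹ =
0`; this is measurable at singular matrices as well. -/
lemma measurable_frobNorm_inv :
    Measurable fun A : Fin p → Fin p → ℝ => frobNorm (Matrix.of A)⁻¹ := by
  have hdet : Continuous fun A : Fin p → Fin p → ℝ => (Matrix.of A).det :=
    Continuous.matrix_det continuous_id
  have hadj : ∀ a b, Continuous fun A : Fin p → Fin p → ℝ => (Matrix.of A).adjugate a b :=
    fun a b => (Continuous.matrix_adjugate continuous_id).matrix_elem a b
  simp only [frobNorm, Matrix.inv_def, Matrix.smul_apply, smul_eq_mul, Ring.inverse_eq_inv']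
  refine Measurable.sqrt (Finset.measurable_sum _ fun a _ => Finset.measurable_sum _ fun b _ => ?_)
  exact (hdet.measurable.inv.mul (hadj a b).measurable).pow_const 2

/-- A differentiable random path of matrices, whose inverses have uniformly bounded moments of
order at least two at each fixed time, almost surely never becomes singular. -/
lemma ae_forall_isUnit_det {P : Measure Ω} {A : Ω → ℝ → Matrix (Fin p) (Fin p) ℝ} {k : ℕ}
    (hk : 2 ≤ k) {C : ℝ≥0}
    (hmeas : ∀ t ∈ Icc (0 : ℝ) 1, AEMeasurable (fun ω => frobNorm (A ω t)⁻¹) P)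
    (hunit : ∀ t ∈ Icc (0 : ℝ) 1, ∀ᵐ ω ∂P, IsUnit (A ω t).det)
    (hmom : ∀ t ∈ Icc (0 : ℝ) 1, ∫⁻ ω, ENNReal.ofReal (frobNorm (A ω t)⁻¹) ^ k ∂P ≤ C)
    (hdiff : ∀ᵐ ω ∂P, ∀ t ∈ Icc (0 : ℝ) 1, ∀ a b, DifferentiableAt ℝ (fun s => A ω s a b) t) :
    ∀ᵐ ω ∂P, ∀ t ∈ Icc (0 : ℝ) 1, IsUnit (A ω t).det := by
  -- Every differentiable path that becomes singular lies in some `bad K`, so null sets suffice. On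
  -- `bad K`, the point of a grid of mesh `1 / n` nearest below the singular time is either singular
  -- itself or has an inverse of norm at least `n / (K + 1)`.
  let bad : ℕ → Set Ω := fun K => {ω | ∃ t ∈ Icc (0 : ℝ) 1, ¬ IsUnit (A ω t).det ∧
    ∀ s, |s - t| ≤ ((K : ℝ) + 1)⁻¹ → frobNorm (A ω s - A ω t) ≤ (K + 1) * |s - t|}
  have hgrid : ∀ K n : ℕ, K + 1 ≤ n → P (bad K) ≤
      ENNReal.ofReal (2 * C * ((K : ℝ) + 1) ^ k / n) := by
    intro K n hn
    have hn0 : (0 : ℝ) < n := by exact_mod_cast (Nat.succ_pos K).trans_le hn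
    have hKn : (K : ℝ) + 1 ≤ n := by exact_mod_cast hn
    have hpt : ∀ j ∈ Finset.range (n + 1), (j : ℝ) / n ∈ Icc (0 : ℝ) 1 := fun j hj =>
      ⟨by positivity, by
        rw [div_le_one hn0]
        exact_mod_cast Nat.lt_succ_iff.1 (Finset.mem_range.1 hj)⟩
    have hsub : bad K ⊆ ⋃ j ∈ Finset.range (n + 1), ({ω | ¬ IsUnit (A ω (j / n)).det} ∪
        {ω | ENNReal.ofReal ((n / (K + 1)) ^ k) ≤
          ENNReal.ofReal (frobNorm (A ω (j / n))⁻¹) ^ k}) := by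
      rintro ω ⟨t, ht, hsing, hlip⟩
      have htn : 0 ≤ t * n := mul_nonneg ht.1 hn0.le
      have hj : ⌊t * n⌋₊ ∈ Finset.range (n + 1) := by
        rw [Finset.mem_range, Nat.lt_succ_iff]
        exact Nat.floor_le_of_le (by nlinarith [ht.2])
      refine mem_biUnion hj ?_
      by_cases hu : IsUnit (A ω (⌊t * n⌋₊ / n)).det
      · right
        have hclose : |(⌊t * n⌋₊ : ℝ) / n - t| ≤ (n : ℝ)⁻¹ := by
          have h1 := Nat.floor_le htn
          have h2 := Nat.lt_floor_add_one (t * n)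
          have h3 : (⌊t * n⌋₊ : ℝ) / n - t = ((⌊t * n⌋₊ : ℝ) - t * n) * (n : ℝ)⁻¹ := by
            field_simp
          rw [h3, abs_mul, abs_of_pos (inv_pos.2 hn0)]
          refine mul_le_of_le_one_left (inv_pos.2 hn0).le (abs_le.2 ⟨?_, ?_⟩) <;> linarith
        have h4 := hlip _ (hclose.trans (inv_anti₀ (by positivity) hKn))
        have h5 := one_le_frobNorm_inv_mul hsing hu
        have h6 : (n : ℝ) / (K + 1) ≤ frobNorm (A ω (⌊t * n⌋₊ / n))⁻¹ := by
          have h7 : 1 ≤ frobNorm (A ω (⌊t * n⌋₊ / n))⁻¹ * ((K + 1) * (n : ℝ)⁻¹) :=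
            h5.trans (mul_le_mul_of_nonneg_left
              (h4.trans (by gcongr)) (frobNorm_nonneg _))
          rw [div_le_iff₀ (by positivity)]
          calc (n : ℝ) = 1 * n := (one_mul _).symm
            _ ≤ _ * n := mul_le_mul_of_nonneg_right h7 hn0.le
            _ = _ := by field_simp
        rw [mem_ofPred_eq, ← ENNReal.ofReal_pow (frobNorm_nonneg _)]
        exact ENNReal.ofReal_le_ofReal (pow_le_pow_left₀ (by positivity) h6 k)
      · exact Or.inl hu
    refine (measure_mono hsub).trans ((measure_biUnion_finset_le _ _).trans ?_)
    have hterm : ∀ j ∈ Finset.range (n + 1), P ({ω | ¬ IsUnit (A ω (j / n)).det} ∪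
        {ω | ENNReal.ofReal ((n / (K + 1)) ^ k) ≤
          ENNReal.ofReal (frobNorm (A ω (j / n))⁻¹) ^ k}) ≤
        ENNReal.ofReal (C / (n / (K + 1)) ^ k) := by
      intro j hj
      refine (measure_union_le _ _).trans ?_
      rw [ae_iff.1 (hunit _ (hpt j hj)), zero_add,
        ENNReal.ofReal_div_of_pos (by positivity), ENNReal.ofReal_coe_nnreal]
      refine (meas_ge_le_lintegral_div ((hmeas _ (hpt j hj)).ennreal_ofReal.pow_const k)
        (by positivity) ENNReal.ofReal_ne_top).trans ?_
      gcongr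
      exact hmom _ (hpt j hj)
    refine (Finset.sum_le_sum hterm).trans ?_
    rw [Finset.sum_const, Finset.card_range, ← ENNReal.ofReal_nsmul]
    refine ENNReal.ofReal_le_ofReal ?_
    -- The union bound has `n + 1` terms of order `n⁻ᵏ`; with `k ≥ 2` the total is `O(1/n)`.
    have h1 : (1 : ℝ) ≤ n := le_trans (by linarith [(Nat.cast_nonneg K : (0 : ℝ) ≤ K)]) hKn
    have h2 : (n : ℝ) ^ 2 ≤ (n : ℝ) ^ k := pow_le_pow_right₀ h1 hk
    rw [nsmul_eq_mul, div_pow, Nat.cast_add, Nat.cast_one]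
    calc ((n : ℝ) + 1) * (C / (n ^ k / (K + 1) ^ k))
        = ((n + 1) * (C * ((K : ℝ) + 1) ^ k)) / n ^ k := by field_simp
      _ ≤ ((2 * n) * (C * ((K : ℝ) + 1) ^ k)) / n ^ 2 := by gcongr; linarith
      _ = _ := by field_simp
  have hbad : ∀ K, P (bad K) = 0 := by
    intro K
    have hlim : Tendsto (fun n : ℕ => ENNReal.ofReal (2 * C * ((K : ℝ) + 1) ^ k / n)) atTop
        (𝓝 0) := by
      rw [← ENNReal.ofReal_zero]
      exact (ENNReal.continuous_ofReal.tendsto 0).comp (tendsto_const_div_atTop_nhds_zero_nat _)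
    exact le_antisymm (ge_of_tendsto hlim
      (eventually_atTop.2 ⟨K + 1, fun n hn => hgrid K n hn⟩)) zero_le
  have hall : ∀ᵐ ω ∂P, ∀ K, ω ∉ bad K :=
    ae_all_iff.2 fun K => measure_eq_zero_iff_ae_notMem.1 (hbad K)
  filter_upwards [hall, hdiff] with ω hω hd t ht
  by_contra hsing
  have hdt : DifferentiableAt ℝ (fun s => (fun a b => A ω s a b : Fin p → Fin p → ℝ)) t :=
    differentiableAt_pi.2 fun a => differentiableAt_pi.2 fun b => hd t ht a b
  obtain ⟨c, hc, hO⟩ := hdt.isBigO_sub.exists_pos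
  obtain ⟨δ, hδ, hball⟩ := Metric.eventually_nhds_iff.1 hO.bound
  -- One index handles both requirements: the window `1 / (K + 1)` must fit inside `δ`, and the
  -- slope must absorb the factor `p` lost from the sup norm to the Frobenius norm.
  obtain ⟨K, hK⟩ := exists_nat_ge (max (p * c) (2 / δ))
  refine hω K ⟨t, ht, hsing, fun s hs => ?_⟩
  have h1 : |s - t| < δ := by
    refine hs.trans_lt ?_
    have : 2 / δ ≤ K := (le_max_right _ _).trans hK
    rw [inv_lt_comm₀ (by positivity) hδ, ← one_div]
    have h2 : 1 / δ ≤ 2 / δ := by gcongr; norm_num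
    linarith
  have h2 := hball (y := s) (by rwa [Real.dist_eq])
  have h3 : ∀ a b, |(A ω s - A ω t) a b| ≤ c * |s - t| := fun a b =>
    ((norm_le_pi_norm ((fun a b => A ω s a b - A ω t a b : Fin p → Fin p → ℝ) a) b).trans
      (norm_le_pi_norm (fun a b => A ω s a b - A ω t a b : Fin p → Fin p → ℝ) a)).trans h2
  calc _ ≤ p * (c * |s - t|) := frobNorm_le_of_forall_abs_le (by positivity) h3
    _ = p * c * |s - t| := by ring
    _ ≤ _ := by
      gcongr
      linarith [(le_max_left (p * c) (2 / δ)).trans hK]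

end Nonsingularity

/-! ### Measurability of derivatives in the observation -/

section DerivativeMeasurability

/-- A directional derivative is an almost everywhere limit of difference quotients, so measurability
at each fixed parameter suffices and joint measurability is not needed. Discarding the first `n₀`
quotients keeps the evaluation points in `U`. -/
lemma aemeasurable_fderiv_apply {𝒵 E : Type*} [MeasurableSpace 𝒵] {ν : Measure 𝒵}
    [NormedAddCommGroup E] [NormedSpace ℝ E] {U : Set E} (hU : IsOpen U) {G : 𝒵 → E → ℝ}
    (hG : ∀ θ ∈ U, AEMeasurable (fun z => G z θ) ν) {θ : E} (hθ : θ ∈ U)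
    (hd : ∀ᵐ z ∂ν, DifferentiableAt ℝ (G z) θ) (v : E) :
    AEMeasurable (fun z => fderiv ℝ (G z) θ v) ν := by
  have hlim : Tendsto (fun n : ℕ => θ + ((n : ℝ))⁻¹ • v) atTop (𝓝 θ) := by
    have := (tendsto_inv_atTop_nhds_zero_nat (𝕜 := ℝ)).smul_const v
    simpa using this.const_add θ
  obtain ⟨n₀, hn₀⟩ := eventually_atTop.1 (hlim.eventually (hU.mem_nhds hθ))
  refine aemeasurable_of_tendsto_metrizable_ae atTop
    (f := fun n : ℕ => fun z => ((n + n₀ : ℕ) : ℝ) • (G z (θ + ((n + n₀ : ℕ) : ℝ)⁻¹ • v) - G z θ))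
    (fun n => ((hG _ (hn₀ (n + n₀) (Nat.le_add_left _ _))).sub (hG θ hθ)).const_smul
      ((n + n₀ : ℕ) : ℝ)) ?_
  filter_upwards [hd] with z hz
  refine hz.hasFDerivAt.lim v ?_
  simp only [Real.norm_natCast]
  exact tendsto_natCast_atTop_atTop.comp (tendsto_add_atTop_nat n₀)

end DerivativeMeasurability

/-! ### Global concavity of the log-likelihood -/

namespace RidgeModel

variable {Ω 𝒵 : Type*} [MeasurableSpace Ω] [MeasurableSpace 𝒵] {p : ℕ} {M : RidgeModel Ω 𝒵 p}

lemma Standing.ae_forall_obs (hM : M.Standing) {q : 𝒵 → Prop} (hq : ∀ᵐ z ∂M.law, q z) :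
    ∀ᵐ ω ∂M.P, ∀ i, q (M.Z i ω) := by
  refine ae_all_iff.2 fun i => ?_
  rw [← hM.obs_law i] at hq
  exact ae_of_ae_map (hM.obs_meas i).aemeasurable hq

lemma Standing.aemeasurable_obs (hM : M.Standing) {g : 𝒵 → ℝ} (hg : AEMeasurable g M.law)
    (i : ℕ) : AEMeasurable (fun ω => g (M.Z i ω)) M.P := by
  rw [← hM.obs_law i] at hg
  exact hg.comp_measurable (hM.obs_meas i)

lemma Standing.ae_smoothAt (hM : M.Standing) : ∀ᵐ z ∂M.law, M.SmoothAt z :=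
  hM.logDens_diff.mono fun _ hz θ hθ => (hz θ hθ).2

lemma Standing.aemeasurable_hess (hM : M.Standing) {θ : EuclideanSpace ℝ (Fin p)}
    (hθ : θ ∈ interior M.Θ) (a b : Fin p) : AEMeasurable (fun z => M.hess z θ a b) M.law := by
  have h0 : ∀ θ ∈ interior M.Θ, AEMeasurable (fun z => M.logDens z θ) M.law := fun θ hθ =>
    (Real.measurable_log.comp (hM.dens_meas θ (interior_subset hθ))).aemeasurable
  have h1 : ∀ w, ∀ θ ∈ interior M.Θ,
      AEMeasurable (fun z => fderiv ℝ (M.logDens z) θ w) M.law := fun w θ hθ =>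
    aemeasurable_fderiv_apply isOpen_interior h0 hθ
      (hM.ae_smoothAt.mono fun z hz => hz.differentiableAt (interior_subset hθ)) w
  have h2 := aemeasurable_fderiv_apply isOpen_interior (h1 (EuclideanSpace.single b 1)) hθ
    (hM.ae_smoothAt.mono fun z hz => (hz.differentiableAt_fderiv (interior_subset hθ)).clm_apply
      (differentiableAt_const _)) (EuclideanSpace.single a 1)
  refine h2.congr (hM.ae_smoothAt.mono fun z hz => ?_)
  change fderiv ℝ (fun θ => fderiv ℝ (M.logDens z) θ (EuclideanSpace.single b 1)) θ
    (EuclideanSpace.single a 1) = M.hess z θ a b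
  rw [hess_apply, ((hz.differentiableAt_fderiv (interior_subset hθ)).hasFDerivAt.clm_apply
    (hasFDerivAt_const (EuclideanSpace.single b 1) θ)).fderiv]
  simp

lemma Standing.aemeasurable_frobNorm_inv_avgHess (hM : M.Standing) (N : ℕ)
    {θ : EuclideanSpace ℝ (Fin p)} (hθ : θ ∈ interior M.Θ) :
    AEMeasurable (fun ω => frobNorm (M.avgHess N ω θ)⁻¹) M.P := by
  refine measurable_frobNorm_inv.comp_aemeasurable (g := fun A : Fin p → Fin p → ℝ =>
    frobNorm (Matrix.of A)⁻¹) (f := fun ω a b => M.avgHess N ω θ a b) ?_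
  refine aemeasurable_pi_lambda _ fun a => aemeasurable_pi_lambda _ fun b => ?_
  simp only [avgHess_apply]
  exact (Finset.aemeasurable_fun_sum _ fun i _ =>
    hM.aemeasurable_obs (hM.aemeasurable_hess hθ a b) i).const_mul _

lemma Standing.lamBar_nonneg (hM : M.Standing) (N : ℕ) : 0 ≤ M.lamBar N := by
  obtain ⟨lam, hlam⟩ := hM.cand_nonempty N
  have := hM.cand_subset N hlam
  exact this.1.trans this.2

/-- The moment hypothesis at `lam = 0` excludes singularity only at each fixed parameter. Here the
exceptional null set no longer depends on the position along the segment. -/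
lemma Standing.ae_isUnit_det_avgHess_segment (hM : M.Standing) (hconv : Convex ℝ M.Θ)
    (hunif : M.UniformMoments 16) : ∃ N₀ : ℕ, ∀ N ≥ N₀, ∀ x ∈ interior M.Θ, ∀ y ∈ interior M.Θ,
      ∀ᵐ ω ∂M.P, ∀ t ∈ Icc (0 : ℝ) 1, IsUnit (M.avgHess N ω (x + t • (y - x))).det := by
  obtain ⟨N₀, C, h⟩ := hunif
  refine ⟨N₀, fun N hN x hx y hy => ?_⟩
  have hmem : ∀ t ∈ Icc (0 : ℝ) 1, x + t • (y - x) ∈ interior M.Θ := fun t ht =>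
    hconv.interior.add_smul_sub_mem hx hy ht
  have hzero : (0 : ℝ) ∈ Icc 0 (M.lamBar N) := ⟨le_rfl, hM.lamBar_nonneg N⟩
  have hmom := fun t ht => (h N hN _ (interior_subset (hmem t ht))).2 0 hzero
  simp only [mul_zero, zero_smul, sub_zero] at hmom
  refine ae_forall_isUnit_det (k := 16) (by norm_num)
    (fun t ht => hM.aemeasurable_frobNorm_inv_avgHess N (hmem t ht))
    (fun t ht => (hmom t ht).1) (fun t ht => (hmom t ht).2) ?_
  filter_upwards [hM.ae_forall_obs hM.ae_smoothAt] with ω hω t ht a b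
  exact DifferentiableAt.comp (g := fun θ => M.avgHess N ω θ a b) t
    (differentiableAt_avgHess hω N (interior_subset (hmem t ht)) a b)
    (f := fun s : ℝ => x + s • (y - x)) (by fun_prop)

/-- In large samples, if the log-likelihood is strictly concave at a point, then it is concave. -/
lemma Standing.ae_avgHess_nonpos (hM : M.Standing) (hconv : Convex ℝ M.Θ)
    (hunif : M.UniformMoments 16) {x : EuclideanSpace ℝ (Fin p)} (hx : x ∈ interior M.Θ) :
    ∃ N₀ : ℕ, ∀ N ≥ N₀, ∀ᵐ ω ∂M.P, (-M.avgHess N ω x).PosDef →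
      ∀ θ ∈ interior M.Θ, ∀ v, inner ℝ v (matVec (M.avgHess N ω θ) v) ≤ 0 := by
  obtain ⟨N₀, h⟩ := hM.ae_isUnit_det_avgHess_segment hconv hunif
  obtain ⟨D, hD, hdense⟩ := TopologicalSpace.exists_countable_dense (EuclideanSpace ℝ (Fin p))
  refine ⟨N₀, fun N hN => ?_⟩
  -- A common null set is available only for countably many endpoints, hence the dense set `D`;
  -- continuity of the Hessian covers the remaining points.
  have hall : ∀ᵐ ω ∂M.P, ∀ y ∈ interior M.Θ ∩ D, ∀ t ∈ Icc (0 : ℝ) 1,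
      IsUnit (M.avgHess N ω (x + t • (y - x))).det :=
    (ae_ball_iff (hD.mono inter_subset_right)).2 fun y hy => h N hN x hx y hy.1
  filter_upwards [hall, hM.ae_forall_obs hM.ae_smoothAt] with ω hω hsm hpos θ hθ v
  have hdenseD : ∀ y ∈ interior M.Θ ∩ D, inner ℝ v (matVec (M.avgHess N ω y) v) ≤ 0 := by
    intro y hy
    have hmem : ∀ t : Icc (0 : ℝ) 1, x + (t : ℝ) • (y - x) ∈ interior M.Θ := fun t =>
      hconv.interior.add_smul_sub_mem hx hy.1 t.2
    have hc : Continuous fun t : Icc (0 : ℝ) 1 => -M.avgHess N ω (x + (t : ℝ) • (y - x)) := by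
      refine continuous_iff_continuousAt.2 fun t => ContinuousAt.neg ?_
      exact (continuousAt_avgHess hsm N (interior_subset (hmem t))).comp
        (f := fun t : Icc (0 : ℝ) 1 => x + (t : ℝ) • (y - x)) (by fun_prop)
    have := posDef_of_path hc (fun t => (isSymm_avgHess hsm N (hmem t)).neg)
      (fun t => by
        rw [Matrix.det_neg]
        exact ((isUnit_one.neg).pow _).mul (hω y hy t t.2)) (s := ⟨0, by simp⟩) (by simpa using hpos)
      ⟨1, by simp⟩
    simp only [one_smul, add_sub_cancel] at this
    by_cases hv : v = 0
    · simp [hv]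
    · have h2 := inner_matVec_pos this hv
      rw [matVec_neg, inner_neg_right] at h2
      linarith
  have hcl : θ ∈ closure (interior M.Θ ∩ D) := hdense.open_subset_closure_inter isOpen_interior hθ
  obtain ⟨u, hu, hlim⟩ := mem_closure_iff_seq_limit.1 hcl
  have hcont : ContinuousAt (fun y => inner ℝ v (matVec (M.avgHess N ω y) v)) θ := by
    simp only [inner_matVec]
    have := fun a b =>
      (differentiableAt_avgHess hsm N (interior_subset hθ) a b).continuousAt
    fun_prop
  exact le_of_tendsto (hcont.tendsto.comp hlim) (Eventually.of_forall fun n => hdenseD _ (hu n))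

end RidgeModel

/-! ### Moment inequalities -/

section Moments

variable {Ω : Type*} [MeasurableSpace Ω] {P : Measure Ω}

lemma MeasureTheory.MemLp.integrable_pow_of_le [IsFiniteMeasure P] {f : Ω → ℝ} {n k : ℕ}
    (hf : MemLp f n P) (hk : k ≤ n) : Integrable (fun ω => f ω ^ k) P := by
  have h := (hf.mono_exponent (p := (k : ℝ≥0∞)) (by exact_mod_cast hk)).integrable_norm_pow'
  refine (integrable_norm_iff (hf.1.pow k)).1 ?_
  simpa using h

lemma integrable_and_integral_le_of_lintegral_le {f : Ω → ℝ} (hf : AEStronglyMeasurable f P)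
    (h0 : ∀ ω, 0 ≤ f ω) {C : ℝ≥0} (h : ∫⁻ ω, ENNReal.ofReal (f ω) ∂P ≤ C) :
    Integrable f P ∧ ∫ ω, f ω ∂P ≤ C := by
  refine ⟨⟨hf, ?_⟩, ?_⟩
  · rw [hasFiniteIntegral_iff_ofReal (Eventually.of_forall h0)]
    exact h.trans_lt ENNReal.coe_lt_top
  · rw [integral_eq_lintegral_of_nonneg_ae (Eventually.of_forall h0) hf]
    exact ENNReal.toReal_le_of_le_ofReal C.2 (by simpa using h)

/-- Second and fourth moments of a sum of independent centred variables. -/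
lemma integral_sum_range_pow_four_le [IsProbabilityMeasure P] {X : ℕ → Ω → ℝ}
    (hindep : iIndepFun X P) (hX : ∀ i, MemLp (X i) 4 P) (h1 : ∀ i, ∫ ω, X i ω ∂P = 0) {s m : ℝ}
    (h2 : ∀ i, ∫ ω, X i ω ^ 2 ∂P = s) (h4 : ∀ i, ∫ ω, X i ω ^ 4 ∂P = m) (N : ℕ) :
    ∫ ω, (∑ i ∈ Finset.range N, X i ω) ^ 2 ∂P = N * s ∧
      ∫ ω, (∑ i ∈ Finset.range N, X i ω) ^ 4 ∂P ≤ 3 * (s ^ 2 + m) * N ^ 2 := by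
  have hm : 0 ≤ m := h4 0 ▸ integral_nonneg fun ω => by positivity
  induction N with
  | zero => simp
  | succ N ih =>
    obtain ⟨ih2, ih4⟩ := ih
    set S : Ω → ℝ := fun ω => ∑ i ∈ Finset.range N, X i ω with hS
    have hSm : MemLp S 4 P := memLp_finsetSum _ fun i _ => hX i
    have hS1 : ∫ ω, S ω ∂P = 0 := by
      rw [hS, integral_finsetSum _ fun i _ => (hX i).integrable (by norm_num)]
      simp [h1]
    have hind : IndepFun S (X N) P := by
      have := hindep.indepFun_sum_range_succ₀ (fun i => (hX i).1.aemeasurable) N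
      convert this using 1
      ext ω
      simp [hS]
    have hSk : ∀ k ≤ 4, Integrable (fun ω => S ω ^ k) P := fun k hk =>
      MemLp.integrable_pow_of_le (n := 4) (by exact_mod_cast hSm) hk
    have hXk : ∀ k ≤ 4, Integrable (fun ω => X N ω ^ k) P := fun k hk =>
      MemLp.integrable_pow_of_le (n := 4) (by exact_mod_cast hX N) hk
    have hprod : ∀ j ≤ 4, ∀ k ≤ 4, Integrable (fun ω => S ω ^ j * X N ω ^ k) P ∧
        ∫ ω, S ω ^ j * X N ω ^ k ∂P = (∫ ω, S ω ^ j ∂P) * ∫ ω, X N ω ^ k ∂P := by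
      intro j hj k hk
      have h := hind.comp (φ := fun x => x ^ j) (ψ := fun x => x ^ k) (by fun_prop) (by fun_prop)
      exact ⟨h.integrable_mul (hSk j hj) (hXk k hk),
        h.integral_fun_mul_eq_mul_integral (hSk j hj).1 (hXk k hk).1⟩
    have hS1' : ∫ ω, S ω ^ 1 ∂P = 0 := by simpa using hS1
    have hX1' : ∫ ω, X N ω ^ 1 ∂P = 0 := by simpa using h1 N
    have p11 := hprod 1 (by norm_num) 1 (by norm_num)
    have p31 := hprod 3 (by norm_num) 1 (by norm_num)
    have p22 := hprod 2 (by norm_num) 2 (by norm_num)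
    have p13 := hprod 1 (by norm_num) 3 (by norm_num)
    simp only [Finset.sum_range_succ]
    constructor
    · have e : ∀ ω, (S ω + X N ω) ^ 2 = S ω ^ 2 + 2 * (S ω ^ 1 * X N ω ^ 1) + X N ω ^ 2 :=
        fun ω => by ring
      calc ∫ ω, (S ω + X N ω) ^ 2 ∂P
          = ∫ ω, S ω ^ 2 + 2 * (S ω ^ 1 * X N ω ^ 1) + X N ω ^ 2 ∂P := by simp_rw [e]
        _ = ∫ ω, S ω ^ 2 ∂P + 2 * ∫ ω, S ω ^ 1 * X N ω ^ 1 ∂P + ∫ ω, X N ω ^ 2 ∂P := by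
          rw [integral_add ((hSk 2 (by norm_num)).fun_add (p11.1.const_mul 2)) (hXk 2 (by norm_num)),
            integral_add (hSk 2 (by norm_num)) (p11.1.const_mul 2), integral_const_mul]
        _ = _ := by rw [p11.2, hS1', ih2, h2]; push_cast; ring
    · have e : ∀ ω, (S ω + X N ω) ^ 4 = S ω ^ 4 + 4 * (S ω ^ 3 * X N ω ^ 1)
          + 6 * (S ω ^ 2 * X N ω ^ 2) + 4 * (S ω ^ 1 * X N ω ^ 3) + X N ω ^ 4 := fun ω => by ring
      have i1 := (hSk 4 le_rfl).fun_add (p31.1.const_mul 4)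
      have i2 := i1.fun_add (p22.1.const_mul 6)
      have i3 := i2.fun_add (p13.1.const_mul 4)
      calc ∫ ω, (S ω + X N ω) ^ 4 ∂P
          = ∫ ω, S ω ^ 4 + 4 * (S ω ^ 3 * X N ω ^ 1)
          + 6 * (S ω ^ 2 * X N ω ^ 2) + 4 * (S ω ^ 1 * X N ω ^ 3) + X N ω ^ 4 ∂P := by simp_rw [e]
        _ = ∫ ω, S ω ^ 4 ∂P + 4 * ∫ ω, S ω ^ 3 * X N ω ^ 1 ∂P
          + 6 * ∫ ω, S ω ^ 2 * X N ω ^ 2 ∂P + 4 * ∫ ω, S ω ^ 1 * X N ω ^ 3 ∂P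
          + ∫ ω, X N ω ^ 4 ∂P := by
          rw [integral_add i3 (hXk 4 le_rfl), integral_add i2 (p13.1.const_mul 4),
            integral_add i1 (p22.1.const_mul 6), integral_add (hSk 4 le_rfl) (p31.1.const_mul 4),
            integral_const_mul, integral_const_mul, integral_const_mul]
        -- Independence and centring kill the terms with an odd power of either factor, leaving only
        -- the `(2, 2)` cross term.
        _ ≤ 3 * (s ^ 2 + m) * N ^ 2 + 6 * (N * s * s) + m := by
          rw [p31.2, p22.2, p13.2, hS1', hX1', ih2, h2, h4]
          linarith
        _ ≤ _ := by
          push_cast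
          nlinarith [mul_nonneg (Nat.cast_nonneg N : (0 : ℝ) ≤ N) hm, sq_nonneg s]

lemma measure_le_of_integral_pow_four_le [IsFiniteMeasure P] {f : Ω → ℝ}
    (hf : Integrable (fun ω => f ω ^ 4) P) {C ε : ℝ} (hε : 0 < ε)
    (h : ∫ ω, f ω ^ 4 ∂P ≤ C) : P {ω | ε ≤ |f ω|} ≤ ENNReal.ofReal (C / ε ^ 4) := by
  have h1 := mul_meas_ge_le_integral_of_nonneg (μ := P)
    (Eventually.of_forall fun ω => by positivity) hf (ε ^ 4)
  have h2 : P {ω | ε ≤ |f ω|} ≤ P {ω | ε ^ 4 ≤ f ω ^ 4} := by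
    refine measure_mono fun ω hω => ?_
    rw [mem_ofPred_eq] at hω ⊢
    rw [← Even.pow_abs (by decide : Even 4) (f ω)]
    exact pow_le_pow_left₀ hε.le hω 4
  refine h2.trans ?_
  rw [← ofReal_measureReal]
  refine ENNReal.ofReal_le_ofReal ?_
  rw [le_div_iff₀ (by positivity)]
  linarith

/-- If `‖Y‖ ≤ c (1 + ‖X‖)` always and `‖Y - X‖ ≤ d / N` off a set of probability `O(1 / N²)`, where
`X` has moments of the order of `N^{-1/2}`, then the second moments of `X` and `Y` are close. -/
lemma abs_integral_sq_sub_le [IsProbabilityMeasure P] {E : Type*} [NormedAddCommGroup E]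
    {X Y : Ω → E} (hY : AEStronglyMeasurable Y P) {n c d b C : ℝ} (hn : 1 ≤ n) (hd : 0 ≤ d)
    (hb : 0 ≤ b) (hX2 : Integrable (fun ω => ‖X ω‖ ^ 2) P)
    (hX4 : Integrable (fun ω => ‖X ω‖ ^ 4) P) (hC2 : n * ∫ ω, ‖X ω‖ ^ 2 ∂P ≤ C)
    (hC4 : n ^ 2 * ∫ ω, ‖X ω‖ ^ 4 ∂P ≤ C) (hcrude : ∀ᵐ ω ∂P, ‖Y ω‖ ≤ c * (1 + ‖X ω‖)) {B : Set Ω}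
    (hB : P B ≤ ENNReal.ofReal (b / n ^ 2)) (hclose : ∀ᵐ ω ∂P, ω ∉ B → ‖Y ω - X ω‖ ≤ d / n) :
    Integrable (fun ω => ‖Y ω‖ ^ 2) P ∧
      n * |∫ ω, ‖Y ω‖ ^ 2 ∂P - ∫ ω, ‖X ω‖ ^ 2 ∂P| ≤
        (d * (1 + C) + d ^ 2 + 2 * c ^ 2 * b + (2 * c ^ 2 + 1) * (b + C)) / √n := by
  have hn0 : 0 < n := one_pos.trans_le hn
  set r := √n with hr
  have hr1 : 1 ≤ r := Real.one_le_sqrt.2 hn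
  have hrr : r ^ 2 = n := Real.sq_sqrt hn0.le
  have hr0 : 0 < r := one_pos.trans_le hr1
  have hY2 : Integrable (fun ω => ‖Y ω‖ ^ 2) P := by
    refine ((integrable_const (2 * c ^ 2)).add (hX2.const_mul (2 * c ^ 2))).mono' (hY.norm.pow 2) ?_
    filter_upwards [hcrude] with ω hω
    rw [Real.norm_of_nonneg (by positivity), Pi.add_apply]
    calc ‖Y ω‖ ^ 2 ≤ (c * (1 + ‖X ω‖)) ^ 2 := by gcongr
      _ ≤ _ := by nlinarith [mul_nonneg (sq_nonneg c) (sq_nonneg (1 - ‖X ω‖))]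
  refine ⟨hY2, ?_⟩
  -- `B` need not be measurable; its measurable hull has the same probability.
  set D := toMeasurable P B with hD
  have hDm : MeasurableSet D := measurableSet_toMeasurable P B
  have hDP : P.real D ≤ b / n ^ 2 := by
    refine ENNReal.toReal_le_of_le_ofReal (by positivity) ?_
    rwa [hD, measure_toMeasurable]
  have hDP0 : 0 ≤ P.real D := measureReal_nonneg
  have hDint : Integrable (D.indicator fun _ => (1 : ℝ)) P := (integrable_const 1).indicator hDm
  have hDval : ∫ ω, D.indicator (fun _ => (1 : ℝ)) ω ∂P = P.real D := by
    rw [integral_indicator hDm]; simp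
  set κ := 2 * c ^ 2 + 1 with hκ
  have hκ0 : 0 ≤ κ := by positivity
  have hpt : ∀ᵐ ω ∂P, n * |‖Y ω‖ ^ 2 - ‖X ω‖ ^ 2| ≤
      (d / r + d ^ 2 / n) + d / r * (n * ‖X ω‖ ^ 2)
        + (2 * c ^ 2 * n + κ * r) * D.indicator (fun _ => (1 : ℝ)) ω
        + κ / r * (n ^ 2 * ‖X ω‖ ^ 4) := by
    filter_upwards [hcrude, hclose] with ω h1 h2
    set x := ‖X ω‖ with hx
    have hx0 : 0 ≤ x := norm_nonneg _
    by_cases hω : ω ∈ D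
    · rw [indicator_of_mem hω]
      have h3 : |‖Y ω‖ ^ 2 - x ^ 2| ≤ 2 * c ^ 2 + κ * x ^ 2 := by
        have h4 : ‖Y ω‖ ^ 2 ≤ (c * (1 + x)) ^ 2 := by gcongr
        have h5 : 0 ≤ c ^ 2 * (1 - x) ^ 2 := by positivity
        have h6 : 0 ≤ c ^ 2 * x ^ 2 := by positivity
        rw [abs_le]
        constructor <;> nlinarith [sq_nonneg ‖Y ω‖, sq_nonneg c, sq_nonneg x]
      -- A weighted arithmetic-geometric mean inequality in place of Cauchy–Schwarz: on integration
      -- the indicator picks up `r * P(D) = O(r / n²)` and the fourth moment the factor `1 / r`,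
      -- both small enough.
      have h4 : n * x ^ 2 ≤ r + 1 / r * (n ^ 2 * x ^ 4) := by
        have h5 : 0 ≤ (r - n * x ^ 2) ^ 2 + r * (n * x ^ 2) := by positivity
        have h6 : r + 1 / r * (n ^ 2 * x ^ 4) - n * x ^ 2 =
            ((r - n * x ^ 2) ^ 2 + r * (n * x ^ 2)) / r := by field_simp; ring
        have h7 : 0 ≤ ((r - n * x ^ 2) ^ 2 + r * (n * x ^ 2)) / r := by positivity
        linarith
      have h5 : 0 ≤ (d / r + d ^ 2 / n) + d / r * (n * x ^ 2) := by positivity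
      calc n * |‖Y ω‖ ^ 2 - x ^ 2| ≤ n * (2 * c ^ 2 + κ * x ^ 2) := by gcongr
        _ = 2 * c ^ 2 * n + κ * (n * x ^ 2) := by ring
        _ ≤ 2 * c ^ 2 * n + κ * (r + 1 / r * (n ^ 2 * x ^ 4)) := by gcongr
        _ = (2 * c ^ 2 * n + κ * r) * 1 + κ / r * (n ^ 2 * x ^ 4) := by ring
        _ ≤ _ := by linarith
    · rw [indicator_of_notMem hω]
      have h3 := h2 fun h => hω (subset_toMeasurable P B h)
      have h4 : |‖Y ω‖ ^ 2 - x ^ 2| ≤ d / n * (2 * x + d / n) := by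
        have h5 : |‖Y ω‖ - x| ≤ d / n := (abs_norm_sub_norm_le _ _).trans h3
        have h6 : ‖Y ω‖ ^ 2 - x ^ 2 = (‖Y ω‖ - x) * (‖Y ω‖ + x) := by ring
        rw [h6, abs_mul, abs_of_nonneg (by positivity : 0 ≤ ‖Y ω‖ + x)]
        exact mul_le_mul h5 (by linarith [(abs_le.1 h5).2]) (by positivity) (by positivity)
      have h5 : 2 * x ≤ 1 / r + 1 / r * (n * x ^ 2) := by
        have h6 : 1 / r + 1 / r * (n * x ^ 2) - 2 * x = (1 - r * x) ^ 2 / r := by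
          rw [← hrr]; field_simp; ring
        have h7 : 0 ≤ (1 - r * x) ^ 2 / r := by positivity
        linarith
      have h6 : 0 ≤ κ / r * (n ^ 2 * x ^ 4) := by positivity
      calc n * |‖Y ω‖ ^ 2 - x ^ 2| ≤ n * (d / n * (2 * x + d / n)) := by gcongr
        _ = d * (2 * x) + d ^ 2 / n := by field_simp
        _ ≤ d * (1 / r + 1 / r * (n * x ^ 2)) + d ^ 2 / n := by gcongr
        _ = (d / r + d ^ 2 / n) + d / r * (n * x ^ 2) + (2 * c ^ 2 * n + κ * r) * 0 := by ring
        _ ≤ _ := by linarith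
  have i1 : Integrable (fun ω => (d / r + d ^ 2 / n) + d / r * (n * ‖X ω‖ ^ 2)) P :=
    (integrable_const _).add ((hX2.const_mul n).const_mul (d / r))
  have i2 := i1.fun_add (hDint.const_mul (2 * c ^ 2 * n + κ * r))
  have i3 : Integrable (fun ω => κ / r * (n ^ 2 * ‖X ω‖ ^ 4)) P :=
    (hX4.const_mul (n ^ 2)).const_mul (κ / r)
  have hsub : Integrable (fun ω => ‖Y ω‖ ^ 2 - ‖X ω‖ ^ 2) P := hY2.sub hX2
  have hmain := integral_mono_ae (hsub.abs.const_mul n) (i2.fun_add i3) hpt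
  have hval : ∫ ω, ((d / r + d ^ 2 / n) + d / r * (n * ‖X ω‖ ^ 2)
        + (2 * c ^ 2 * n + κ * r) * D.indicator (fun _ => (1 : ℝ)) ω
        + κ / r * (n ^ 2 * ‖X ω‖ ^ 4)) ∂P =
      (d / r + d ^ 2 / n) + d / r * (n * ∫ ω, ‖X ω‖ ^ 2 ∂P) + (2 * c ^ 2 * n + κ * r) * P.real D
        + κ / r * (n ^ 2 * ∫ ω, ‖X ω‖ ^ 4 ∂P) := by
    rw [integral_add i2 i3, integral_add i1 (hDint.const_mul _),
      integral_add (integrable_const _) ((hX2.const_mul n).const_mul (d / r))]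
    simp only [integral_const_mul, hDval]
    simp
  have hleft : n * |∫ ω, ‖Y ω‖ ^ 2 ∂P - ∫ ω, ‖X ω‖ ^ 2 ∂P| ≤
      ∫ ω, n * |‖Y ω‖ ^ 2 - ‖X ω‖ ^ 2| ∂P := by
    rw [integral_const_mul, ← integral_sub hY2 hX2]
    gcongr
    exact abs_integral_le_integral_abs
  refine hleft.trans (hmain.trans ?_)
  refine (le_of_eq hval).trans ?_
  have e1 : d ^ 2 / n ≤ d ^ 2 / r := by
    gcongr
    nlinarith
  have e2 : (2 * c ^ 2 * n + κ * r) * P.real D ≤ 2 * c ^ 2 * b / r + κ * b / r := by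
    calc _ ≤ (2 * c ^ 2 * n + κ * r) * (b / n ^ 2) := by gcongr
      _ = 2 * c ^ 2 * b / (r * r) + κ * b / (r * (r * r)) := by
        rw [← hrr]; field_simp
      _ ≤ _ := by
        gcongr
        · nlinarith
        · nlinarith [mul_le_mul hr1 hr1 zero_le_one hr0.le]
  calc _ ≤ (d / r + d ^ 2 / r) + d / r * C + (2 * c ^ 2 * b / r + κ * b / r) + κ / r * C := by
        gcongr
    _ = _ := by field_simp; ring

end Moments

/-! ### Sums over the sample and deviations of sample means -/

namespace RidgeModel

variable {Ω 𝒵 : Type*} [MeasurableSpace Ω] [MeasurableSpace 𝒵] {p : ℕ} {M : RidgeModel Ω 𝒵 p}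

lemma Standing.isProbabilityMeasure_law (hM : M.Standing) : IsProbabilityMeasure M.law := by
  have := hM.prob
  rw [← hM.obs_law 0]
  exact Measure.isProbabilityMeasure_map (hM.obs_meas 0).aemeasurable

lemma Standing.memLp_obs (hM : M.Standing) {g : 𝒵 → ℝ} {q : ℝ≥0∞} (hg : MemLp g q M.law) (i : ℕ) :
    MemLp (fun ω => g (M.Z i ω)) q M.P :=
  hg.comp_measurePreserving ⟨hM.obs_meas i, hM.obs_law i⟩

lemma Standing.integral_obs (hM : M.Standing) {g : 𝒵 → ℝ} (hg : AEStronglyMeasurable g M.law)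
    (i : ℕ) : ∫ ω, g (M.Z i ω) ∂M.P = ∫ z, g z ∂M.law := by
  rw [← hM.obs_law i] at hg ⊢
  exact (integral_map (hM.obs_meas i).aemeasurable hg).symm

lemma Standing.memLp_sum_obs (hM : M.Standing) {g : 𝒵 → ℝ} {q : ℝ≥0∞} (hg : MemLp g q M.law)
    (N : ℕ) : MemLp (fun ω => ∑ i ∈ Finset.range N, g (M.Z i ω)) q M.P :=
  memLp_finsetSum _ fun i _ => hM.memLp_obs hg i

lemma Standing.integral_sum_obs (hM : M.Standing) {g : 𝒵 → ℝ} (hg : MemLp g 4 M.law)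
    (hmean : ∫ z, g z ∂M.law = 0) : ∃ K > 0, ∀ N : ℕ,
      ∫ ω, (∑ i ∈ Finset.range N, g (M.Z i ω)) ^ 2 ∂M.P = N * ∫ z, g z ^ 2 ∂M.law ∧
      ∫ ω, (∑ i ∈ Finset.range N, g (M.Z i ω)) ^ 4 ∂M.P ≤ K * N ^ 2 := by
  have := hM.prob
  have h4 : 0 ≤ ∫ z, g z ^ 4 ∂M.law := integral_nonneg fun z => by positivity
  -- The extra one makes the constant strictly positive, so that it can be divided by later.
  refine ⟨3 * ((∫ z, g z ^ 2 ∂M.law) ^ 2 + ∫ z, g z ^ 4 ∂M.law) + 1, by positivity, fun N => ?_⟩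
  have hindep : iIndepFun (fun i ω => g (M.Z i ω)) M.P :=
    hM.obs_indep.comp₀ (fun _ => g) (fun i => (hM.obs_meas i).aemeasurable) fun i => by
      rw [hM.obs_law i]; exact hg.1.aemeasurable
  obtain ⟨h2, h4'⟩ := integral_sum_range_pow_four_le hindep (fun i => hM.memLp_obs hg i)
    (fun i => (hM.integral_obs hg.1 i).trans hmean) (fun i => hM.integral_obs (hg.1.pow 2) i)
    (fun i => hM.integral_obs (hg.1.pow 4) i) N
  simp only [Pi.pow_apply] at h2 h4'
  exact ⟨h2, h4'.trans (by gcongr; linarith)⟩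

/-- Large deviations of a sample mean from its expectation have probability `O(N⁻²)`. -/
lemma Standing.measure_deviation_le (hM : M.Standing) {g : 𝒵 → ℝ} (hg : MemLp g 4 M.law) {ε : ℝ}
    (hε : 0 < ε) : ∃ K ≥ 0, ∀ N : ℕ, 1 ≤ N →
      M.P {ω | ε ≤ |(N : ℝ)⁻¹ * ∑ i ∈ Finset.range N, g (M.Z i ω) - ∫ z, g z ∂M.law|} ≤
        ENNReal.ofReal (K / (N : ℝ) ^ 2) := by
  have := hM.prob
  have := hM.isProbabilityMeasure_law
  set μ := ∫ z, g z ∂M.law with hμ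
  have hg' : MemLp (fun z => g z - μ) 4 M.law := hg.sub (memLp_const μ)
  obtain ⟨K, hK, h⟩ := hM.integral_sum_obs hg' (by
    rw [integral_sub (hg.integrable (by norm_num)) (integrable_const _)]
    simp [hμ])
  refine ⟨K / ε ^ 4, by positivity, fun N hN => ?_⟩
  have hN0 : (0 : ℝ) < N := by exact_mod_cast hN
  have hset : {ω | ε ≤ |(N : ℝ)⁻¹ * ∑ i ∈ Finset.range N, g (M.Z i ω) - μ|} =
      {ω | ε * N ≤ |∑ i ∈ Finset.range N, (g (M.Z i ω) - μ)|} := by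
    ext ω
    have h1 : (N : ℝ)⁻¹ * ∑ i ∈ Finset.range N, g (M.Z i ω) - μ =
        (∑ i ∈ Finset.range N, (g (M.Z i ω) - μ)) / N := by
      rw [Finset.sum_sub_distrib]
      simp
      field_simp
    rw [mem_ofPred_eq, mem_ofPred_eq, h1, abs_div, abs_of_pos hN0, le_div_iff₀ hN0]
  rw [hset]
  refine (measure_le_of_integral_pow_four_le (MemLp.integrable_pow_of_le (n := 4)
    (by exact_mod_cast hM.memLp_sum_obs hg' N) le_rfl) (by positivity) (h N).2).trans_eq ?_
  congr 1
  field_simp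

end RidgeModel

/-! ### Gram matrices as squared norms -/

section Transpose

variable {p : ℕ}

lemma inner_matVec_transpose_mul (A : Matrix (Fin p) (Fin p) ℝ) (x : EuclideanSpace ℝ (Fin p)) :
    inner ℝ x (matVec (Aᵀ * A) x) = ‖matVec A x‖ ^ 2 := by
  rw [← real_inner_self_eq_norm_sq, matVec_mul, inner_matVec, inner_eq_sum_mul, Finset.sum_comm]
  refine Finset.sum_congr rfl fun b _ => ?_
  rw [← Finset.sum_mul]
  congr 1
  rw [matVec_apply]
  exact Finset.sum_congr rfl fun a _ => by rw [Matrix.transpose_apply, mul_comm]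

end Transpose

/-! ### Lipschitz Hessians, moments of the MLE and the crude bound -/

namespace RidgeModel

variable {Ω 𝒵 : Type*} [MeasurableSpace Ω] [MeasurableSpace 𝒵] {p : ℕ} {M : RidgeModel Ω 𝒵 p}

/-- Lets the Lipschitz hypothesis, stated for arrays, control quadratic forms of the Hessian matrix.
-/
lemma frobNorm_hess_sub (z : 𝒵) (θ η : EuclideanSpace ℝ (Fin p)) :
    frobNorm (M.hess z θ - M.hess z η) = ‖M.H 1 z θ - M.H 1 z η‖ := by
  rw [frobNorm, EuclideanSpace.norm_eq]
  congr 1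
  rw [← Fintype.sum_prod_type', ← (finTwoArrowEquiv (Fin p)).symm.sum_comp]
  refine Finset.sum_congr rfl fun x _ => ?_
  simp [hess]

lemma abs_inner_avgHess_sub_le {N : ℕ} {ω : Ω} {θ η : EuclideanSpace ℝ (Fin p)} {m : 𝒵 → ℝ}
    (h : ∀ i, ‖M.H 1 (M.Z i ω) θ - M.H 1 (M.Z i ω) η‖ ≤ ‖θ - η‖ * m (M.Z i ω))
    (v : EuclideanSpace ℝ (Fin p)) :
    |inner ℝ v (matVec (M.avgHess N ω θ) v) - inner ℝ v (matVec (M.avgHess N ω η) v)| ≤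
      ‖θ - η‖ * ((N : ℝ)⁻¹ * ∑ i ∈ Finset.range N, m (M.Z i ω)) * ‖v‖ ^ 2 := by
  rw [inner_matVec_avgHess, inner_matVec_avgHess, ← mul_sub, ← Finset.sum_sub_distrib, abs_mul,
    abs_of_nonneg (by positivity : (0 : ℝ) ≤ (N : ℝ)⁻¹)]
  calc (N : ℝ)⁻¹ * |∑ i ∈ Finset.range N, (inner ℝ v (matVec (M.hess (M.Z i ω) θ) v)
          - inner ℝ v (matVec (M.hess (M.Z i ω) η) v))|
      ≤ (N : ℝ)⁻¹ * ∑ i ∈ Finset.range N, ‖θ - η‖ * m (M.Z i ω) * ‖v‖ ^ 2 := by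
        gcongr
        refine (Finset.abs_sum_le_sum_abs _ _).trans (Finset.sum_le_sum fun i _ => ?_)
        rw [← inner_sub_right, ← matVec_sub]
        refine (abs_inner_matVec_le _ _).trans ?_
        rw [frobNorm_hess_sub]
        gcongr
        exact h i
    _ = _ := by rw [← Finset.sum_mul, ← Finset.mul_sum]; ring

lemma Standing.aestronglyMeasurable_est (hM : M.Standing) {N : ℕ} {lam : ℝ}
    (hlam : lam ∈ Icc 0 (M.lamBar N)) :
    AEStronglyMeasurable (fun ω => M.est N lam ω - M.θ₀) M.P :=
  ((hM.est_meas N lam hlam).sub_const _).aestronglyMeasurable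

lemma Standing.zero_mem_Icc (hM : M.Standing) (N : ℕ) : (0 : ℝ) ∈ Icc 0 (M.lamBar N) :=
  ⟨le_rfl, hM.lamBar_nonneg N⟩

/-- Second and fourth moments of the error of the MLE. -/
lemma MLEMoments.exists_bound (hM : M.Standing) (hmle : M.MLEMoments 16) :
    ∃ C : ℝ, 0 ≤ C ∧ ∀ᶠ N : ℕ in atTop,
      Integrable (fun ω => ‖M.mle N ω - M.θ₀‖ ^ 2) M.P ∧
      Integrable (fun ω => ‖M.mle N ω - M.θ₀‖ ^ 4) M.P ∧
      N * ∫ ω, ‖M.mle N ω - M.θ₀‖ ^ 2 ∂M.P ≤ C ∧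
      (N : ℝ) ^ 2 * ∫ ω, ‖M.mle N ω - M.θ₀‖ ^ 4 ∂M.P ≤ C := by
  have := hM.prob
  obtain ⟨C, hC⟩ := hmle.moment
  have hlt : limsup (fun N : ℕ => ∫⁻ ω, ‖√(N : ℝ) • (M.mle N ω - M.θ₀)‖ₑ ^ 16 ∂M.P) atTop <
      ((C + 1 : ℝ≥0) : ℝ≥0∞) := hC.trans_lt (by exact_mod_cast lt_add_one C)
  -- Since `e ^ k ≤ 1 + e ^ 16` for `k ≤ 16`, one constant bounds all the lower moments; `C + 1` is
  -- there because a limsup at most `C` gives only eventual values below `C + 1`.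
  obtain ⟨K, hK⟩ : ∃ K : ℝ≥0, K = 1 + (C + 1) := ⟨_, rfl⟩
  refine ⟨K, K.2, ?_⟩
  filter_upwards [eventually_lt_of_limsup_lt hlt, eventually_ge_atTop 1] with N hN hN1
  have hN0 : (0 : ℝ) < N := by exact_mod_cast hN1
  have hmeas : AEStronglyMeasurable (fun ω => √(N : ℝ) • (M.mle N ω - M.θ₀)) M.P :=
    (hM.aestronglyMeasurable_est (hM.zero_mem_Icc N)).const_smul (√(N : ℝ))
  have key : ∀ k ≤ 16, Integrable (fun ω => ‖√(N : ℝ) • (M.mle N ω - M.θ₀)‖ ^ k) M.P ∧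
      ∫ ω, ‖√(N : ℝ) • (M.mle N ω - M.θ₀)‖ ^ k ∂M.P ≤ K := by
    intro k hk
    have hle : ∫⁻ ω, ENNReal.ofReal (‖√(N : ℝ) • (M.mle N ω - M.θ₀)‖ ^ k) ∂M.P ≤ K := by
      calc ∫⁻ ω, ENNReal.ofReal (‖√(N : ℝ) • (M.mle N ω - M.θ₀)‖ ^ k) ∂M.P
          ≤ ∫⁻ ω, 1 + ‖√(N : ℝ) • (M.mle N ω - M.θ₀)‖ₑ ^ 16 ∂M.P := by
            refine lintegral_mono fun ω => ?_
            rw [ENNReal.ofReal_pow (norm_nonneg _), ofReal_norm]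
            generalize ‖√(N : ℝ) • (M.mle N ω - M.θ₀)‖ₑ = e
            rcases le_total e 1 with h | h
            · exact (pow_le_one₀ zero_le h).trans le_self_add
            · exact (pow_le_pow_right₀ h hk).trans le_add_self
        _ = 1 + ∫⁻ ω, ‖√(N : ℝ) • (M.mle N ω - M.θ₀)‖ₑ ^ 16 ∂M.P := by
            rw [lintegral_add_left measurable_const]; simp
        _ ≤ 1 + ((C + 1 : ℝ≥0) : ℝ≥0∞) := add_le_add le_rfl hN.le
        _ = K := by rw [hK]; push_cast; rfl
    exact integrable_and_integral_le_of_lintegral_le (hmeas.norm.pow k)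
      (fun ω => pow_nonneg (norm_nonneg _) k) hle
  have e2 : ∀ ω, ‖√(N : ℝ) • (M.mle N ω - M.θ₀)‖ ^ 2 = N * ‖M.mle N ω - M.θ₀‖ ^ 2 := fun ω => by
    rw [norm_smul, mul_pow, Real.norm_of_nonneg (Real.sqrt_nonneg _), Real.sq_sqrt hN0.le]
  have e4 : ∀ ω, ‖√(N : ℝ) • (M.mle N ω - M.θ₀)‖ ^ 4 = (N : ℝ) ^ 2 * ‖M.mle N ω - M.θ₀‖ ^ 4 :=
    fun ω => by
      have : ∀ x : ℝ, x ^ 4 = (x ^ 2) ^ 2 := fun x => by ring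
      rw [this, e2, this ‖M.mle N ω - M.θ₀‖]; ring
  have k2 := key 2 (by norm_num)
  have k4 := key 4 (by norm_num)
  simp only [e2, integral_const_mul] at k2
  simp only [e4, integral_const_mul] at k4
  exact ⟨(integrable_const_mul_iff (IsUnit.mk0 _ hN0.ne') _).1 k2.1,
    (integrable_const_mul_iff (IsUnit.mk0 _ (pow_pos hN0 2).ne') _).1 k4.1, k2.2, k4.2⟩

/-- The penalty can only move the estimator towards the target. -/
lemma Standing.exists_norm_est_sub_le (hM : M.Standing) : ∃ c, 0 ≤ c ∧ ∀ᶠ N in atTop,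
    ∀ lam ∈ Icc 0 (M.lamBar N), ∀ᵐ ω ∂M.P,
      ‖M.est N lam ω - M.θ₀‖ ≤ c * (1 + ‖M.mle N ω - M.θ₀‖) := by
  obtain ⟨g, hg, hgram⟩ := exists_le_inner_matVec hM.gram_posDef
  set F := frobNorm M.weight with hF
  have hF0 : 0 ≤ F := frobNorm_nonneg _
  set κ := F / √g with hκ
  have hκ0 : 0 ≤ κ := by positivity
  set D := ‖M.target - M.θ₀‖ with hD
  have hD0 : 0 ≤ D := norm_nonneg _
  refine ⟨1 + κ * (1 + D) + D, by positivity, ?_⟩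
  filter_upwards [hM.est_argmax] with N hN lam hlam
  rcases hlam.1.eq_or_lt with rfl | hpos
  · refine Eventually.of_forall fun ω => ?_
    change ‖M.mle N ω - M.θ₀‖ ≤ _
    nlinarith [norm_nonneg (M.mle N ω - M.θ₀),
      mul_nonneg (by positivity : 0 ≤ κ * (1 + D) + D) (norm_nonneg (M.mle N ω - M.θ₀)),
      mul_nonneg hκ0 (by positivity : 0 ≤ 1 + D)]
  filter_upwards [hN lam hlam, hN 0 (hM.zero_mem_Icc N)] with ω h1 h0
  have h2 := h1.2 _ h0.1
  have h3 := h0.2 _ h1.1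
  simp only [penLik, zero_mul, sub_zero] at h2 h3
  -- The MLE has the larger likelihood and the ridge estimator the larger penalised one, so for `lam
  -- > 0` its penalty is the smaller.
  have h4 : ‖matVec M.weight (M.est N lam ω - M.target)‖ ^ 2 ≤
      ‖matVec M.weight (M.est N 0 ω - M.target)‖ ^ 2 := by
    by_contra! h
    nlinarith
  have h5 : ‖M.est N lam ω - M.target‖ ≤ κ * ‖M.mle N ω - M.target‖ := by
    have h6 : g * ‖M.est N lam ω - M.target‖ ^ 2 ≤ (F * ‖M.mle N ω - M.target‖) ^ 2 := by
      refine (hgram _).trans ?_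
      rw [gram, inner_matVec_transpose_mul]
      exact h4.trans (pow_le_pow_left₀ (norm_nonneg _) (norm_matVec_le _ _) 2)
    have h7 : √g * ‖M.est N lam ω - M.target‖ ≤ F * ‖M.mle N ω - M.target‖ := by
      refine (pow_le_pow_iff_left₀ (by positivity) (by positivity) two_ne_zero).1 ?_
      rwa [mul_pow, Real.sq_sqrt hg.le]
    rw [hκ, div_mul_eq_mul_div, le_div_iff₀ (Real.sqrt_pos.2 hg)]
    linarith
  have h6 : ‖M.mle N ω - M.target‖ ≤ ‖M.mle N ω - M.θ₀‖ + D := by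
    have := norm_sub_le (M.mle N ω - M.θ₀) (M.target - M.θ₀)
    simpa using this
  have h7 : ‖M.est N lam ω - M.θ₀‖ ≤ ‖M.est N lam ω - M.target‖ + D := by
    have := norm_add_le (M.est N lam ω - M.target) (M.target - M.θ₀)
    simpa using this
  have h8 : κ * ‖M.mle N ω - M.target‖ ≤ κ * (‖M.mle N ω - M.θ₀‖ + D) := by gcongr
  have hx := norm_nonneg (M.mle N ω - M.θ₀)
  nlinarith [mul_nonneg hκ0 hD0, mul_nonneg (mul_nonneg hκ0 hD0) hx, mul_nonneg hD0 hx]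

lemma TrueValueMoments.memLp_hess (htrue : M.TrueValueMoments 8) (a b : Fin p) :
    MemLp (fun z => M.hess z M.θ₀ a b) 4 M.law :=
  (EuclideanSpace.proj (𝕜 := ℝ) ![a, b]).comp_memLp' htrue.hess

lemma TrueValueMoments.memLp_score (hM : M.Standing) (htrue : M.TrueValueMoments 8) (a : Fin p) :
    MemLp (fun z => M.score z M.θ₀ a) 4 M.law := by
  have := hM.isProbabilityMeasure_law
  exact ((EuclideanSpace.proj (𝕜 := ℝ) a).comp_memLp' htrue.score).mono_exponent
    (by norm_num : (4 : ℝ≥0∞) ≤ (8 : ℕ))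

end RidgeModel

/-! ### Closeness to the MLE and the lower bound on its risk -/

namespace RidgeModel

variable {Ω 𝒵 : Type*} [MeasurableSpace Ω] [MeasurableSpace 𝒵] {p : ℕ} {M : RidgeModel Ω 𝒵 p}

/-- Off an event of probability `O(N⁻²)` the MLE is close to the true value and the log-likelihood
is uniformly strongly concave around the true value. -/
lemma Standing.exists_concave_event (hM : M.Standing) (hlocal : M.LocalRegularity)
    (hlip : M.LipschitzDerivatives 8) (hmle : M.MLEMoments 16) (hreg : M.MLERegularity)
    (htrue : M.TrueValueMoments 8) : ∃ r > 0, ∃ c > 0, ∃ b, 0 ≤ b ∧ Metric.ball M.θ₀ r ⊆ M.Θ ∧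
      ∀ᶠ N : ℕ in atTop, ∃ B : Set Ω, M.P B ≤ ENNReal.ofReal (b / (N : ℝ) ^ 2) ∧
        ∀ᵐ ω ∂M.P, ω ∉ B → ‖M.mle N ω - M.θ₀‖ < r / 2 ∧ ∀ θ ∈ Metric.ball M.θ₀ r, ∀ v,
          inner ℝ v (matVec (M.avgHess N ω θ) v) ≤ -(c * ‖v‖ ^ 2) := by
  have := hM.prob
  have := hM.isProbabilityMeasure_law
  obtain ⟨r₀, hr₀, hball, -⟩ := hlocal.smooth
  obtain ⟨ρ, hρ, m, hm, hmlip⟩ := hlip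
  obtain ⟨c, hc, hcov⟩ := exists_le_inner_matVec hreg.posDef
  obtain ⟨C, hC0, hC⟩ := hmle.exists_bound hM
  set μ := ∫ z, m z ∂M.law with hμ
  -- Of the coercivity constant `c` of the information matrix, `c / 4` is given up to the Lipschitz
  -- change over the ball, whose average constant is at most `|μ| + 1`, and `c / 4` to the entrywise
  -- deviation `ε` at `θ₀`. This leaves `c / 2`.
  set r := min (min r₀ ρ) (c / (4 * (|μ| + 1))) with hr
  have hr0 : 0 < r := by positivity
  set ε := c / (4 * (p + 1)) with hε
  have hε0 : 0 < ε := by positivity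
  choose K hK0 hK using fun q : Fin p × Fin p =>
    hM.measure_deviation_le (htrue.memLp_hess q.1 q.2) hε0
  obtain ⟨L, hL0, hL⟩ := hM.measure_deviation_le
    (hm.mono_exponent (by norm_num : (4 : ℝ≥0∞) ≤ (8 : ℕ))) one_pos
  refine ⟨r, hr0, c / 2, by positivity, C / (r / 2) ^ 4 + (∑ q, K q + L), ?_,
    (Metric.ball_subset_ball ((min_le_left _ _).trans (min_le_left _ _))).trans hball, ?_⟩
  · have := Finset.sum_nonneg fun q (_ : q ∈ Finset.univ) => hK0 q
    positivity
  filter_upwards [hC, eventually_ge_atTop 1] with N hCN hN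
  have hN0 : (0 : ℝ) < N := by exact_mod_cast hN
  let B₁ : Set Ω := {ω | r / 2 ≤ |‖M.mle N ω - M.θ₀‖|}
  let B₂ : Fin p × Fin p → Set Ω := fun q => {ω | ε ≤ |(N : ℝ)⁻¹ *
    ∑ i ∈ Finset.range N, M.hess (M.Z i ω) M.θ₀ q.1 q.2 - ∫ z, M.hess z M.θ₀ q.1 q.2 ∂M.law|}
  let B₃ : Set Ω := {ω | 1 ≤ |(N : ℝ)⁻¹ * ∑ i ∈ Finset.range N, m (M.Z i ω) - μ|}
  refine ⟨B₁ ∪ ((⋃ q, B₂ q) ∪ B₃), ?_, ?_⟩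
  · have h1 : M.P B₁ ≤ ENNReal.ofReal (C / (r / 2) ^ 4 / (N : ℝ) ^ 2) := by
      refine (measure_le_of_integral_pow_four_le hCN.2.1 (by positivity : 0 < r / 2)
        (C := C / (N : ℝ) ^ 2) ?_).trans_eq ?_
      · rw [le_div_iff₀ (by positivity)]
        linarith [hCN.2.2.2]
      · congr 1
        field_simp
    have h2 : M.P (⋃ q, B₂ q) ≤ ENNReal.ofReal ((∑ q, K q) / (N : ℝ) ^ 2) := by
      rw [Finset.sum_div, ENNReal.ofReal_sum_of_nonneg fun q _ => div_nonneg (hK0 q) (by positivity)]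
      exact (measure_iUnion_fintype_le _ _).trans (Finset.sum_le_sum fun q _ => hK q N hN)
    have h3 : M.P B₃ ≤ ENNReal.ofReal (L / (N : ℝ) ^ 2) := hL N hN
    have hKsum := Finset.sum_nonneg fun q (_ : q ∈ Finset.univ) => hK0 q
    rw [add_div, add_div, ENNReal.ofReal_add (by positivity) (by positivity),
      ENNReal.ofReal_add (by positivity) (by positivity)]
    exact (measure_union_le _ _).trans (add_le_add h1
      ((measure_union_le _ _).trans (add_le_add h2 h3)))
  filter_upwards [hM.ae_forall_obs hmlip] with ω hω hB
  simp only [mem_union, mem_iUnion, not_or, not_exists] at hB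
  obtain ⟨hB1, hB2, hB3⟩ := hB
  refine ⟨by simpa [B₁] using hB1, fun θ hθ v => ?_⟩
  have hθ' : ‖θ - M.θ₀‖ < r := by rwa [← dist_eq_norm]
  have hentry : ∀ a b, |(M.avgHess N ω M.θ₀ - M.meanHess) a b| ≤ ε := by
    intro a b
    have := hB2 (a, b)
    simp only [B₂, mem_ofPred_eq, not_le] at this
    rw [Matrix.sub_apply, avgHess_apply]
    exact this.le
  have hfrob : frobNorm (M.avgHess N ω M.θ₀ - M.meanHess) ≤ c / 4 := by
    refine (frobNorm_le_of_forall_abs_le hε0.le hentry).trans ?_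
    rw [hε, mul_div_assoc', div_le_div_iff₀ (by positivity) (by positivity)]
    nlinarith
  have h1 := (abs_le.1 (abs_inner_matVec_le (M.avgHess N ω M.θ₀ - M.meanHess) v)).2
  rw [matVec_sub, inner_sub_right] at h1
  have h2 := (abs_le.1 (abs_inner_avgHess_sub_le (N := N) (fun i => hω i θ
    (Metric.ball_subset_ball ((min_le_left _ _).trans (min_le_right _ _)) hθ) 1 (by simp)) v)).2
  have h3 : inner ℝ v (matVec M.meanHess v) ≤ -(c * ‖v‖ ^ 2) := by
    have := hcov v
    rw [hreg.information, matVec_neg, inner_neg_right] at this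
    linarith
  have h4 : (N : ℝ)⁻¹ * ∑ i ∈ Finset.range N, m (M.Z i ω) ≤ |μ| + 1 := by
    simp only [B₃, mem_ofPred_eq, not_le] at hB3
    linarith [(abs_lt.1 hB3).2, le_abs_self μ]
  have h5 : ‖θ - M.θ₀‖ * ((N : ℝ)⁻¹ * ∑ i ∈ Finset.range N, m (M.Z i ω)) ≤ c / 4 := by
    calc _ ≤ ‖θ - M.θ₀‖ * (|μ| + 1) := by gcongr
      _ ≤ c / (4 * (|μ| + 1)) * (|μ| + 1) := by gcongr; exact hθ'.le.trans (min_le_right _ _)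
      _ = c / 4 := by field_simp
  have h6 := mul_le_mul_of_nonneg_right h5 (sq_nonneg ‖v‖)
  have h7 := mul_le_mul_of_nonneg_right hfrob (sq_nonneg ‖v‖)
  linarith

/-- Off an event of probability `O(N⁻²)` the ridge estimators are within `O(N⁻¹)` of the MLE. -/
lemma Standing.exists_close_event (hM : M.Standing) (hconv : Convex ℝ M.Θ)
    (hlocal : M.LocalRegularity) (hlip : M.LipschitzDerivatives 8) (hmle : M.MLEMoments 16)
    (hreg : M.MLERegularity) (htrue : M.TrueValueMoments 8) (hunif : M.UniformMoments 16) :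
    ∃ b d, 0 ≤ b ∧ 0 ≤ d ∧ ∀ᶠ N : ℕ in atTop, ∃ B : Set Ω,
      M.P B ≤ ENNReal.ofReal (b / (N : ℝ) ^ 2) ∧ ∀ lam ∈ Icc 0 (M.lamBar N), ∀ᵐ ω ∂M.P, ω ∉ B →
        ‖M.est N lam ω - M.mle N ω‖ ≤ d / N := by
  obtain ⟨r, hr, c, hc, b, hb, hball, hev⟩ :=
    hM.exists_concave_event hlocal hlip hmle hreg htrue
  have hint : M.θ₀ ∈ interior M.Θ :=
    interior_maximal hball Metric.isOpen_ball (Metric.mem_ball_self hr)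
  obtain ⟨N₀, hN₀⟩ := hM.ae_avgHess_nonpos hconv hunif hint
  obtain ⟨c₁, hc₁, hcrude⟩ := hM.exists_norm_est_sub_le
  obtain ⟨κ, hκ, hbar⟩ := hM.lamBar_rate.exists_pos
  set F := frobNorm M.gram with hF
  have hF0 : 0 ≤ F := frobNorm_nonneg _
  -- Bounds the distance from any ridge estimator to the target off the exceptional event, where the
  -- MLE error is below `r / 2`.
  set D := c₁ * (1 + r / 2) + ‖M.θ₀ - M.target‖ with hD
  have hD0 : 0 ≤ D := by positivity
  set d := 2 / c * κ * F * D with hd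
  have hd0 : 0 ≤ d := by positivity
  have hsmall : ∀ᶠ N : ℕ in atTop, d / (N : ℝ) < r / 2 :=
    (tendsto_const_div_atTop_nhds_zero_nat d).eventually (gt_mem_nhds (by positivity))
  refine ⟨b, d, hb, hd0, ?_⟩
  filter_upwards [hev, hcrude, hM.est_argmax, hM.est_foc, hbar.bound, hsmall,
    eventually_ge_atTop N₀, eventually_ge_atTop 1] with N hev hcrude hmax hfoc hbar hsmall hNN hN1
  have hN0 : (0 : ℝ) < N := by exact_mod_cast hN1
  obtain ⟨B, hB, hBev⟩ := hev
  refine ⟨B, hB, fun lam hlam => ?_⟩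
  have h0 := hM.zero_mem_Icc N
  filter_upwards [hBev, hcrude lam hlam, hmax lam hlam, hmax 0 h0, hfoc lam hlam, hfoc 0 h0,
    hN₀ N hNN, hM.ae_forall_obs hM.ae_smoothAt] with ω hω hcr hmax1 hmax0 hfoc1 hfoc0 hneg hsm hωB
  obtain ⟨hx, hconc⟩ := hω hωB
  have hpos : (-M.avgHess N ω M.θ₀).PosDef := by
    refine posDef_of_isSymm (isSymm_avgHess hsm N hint).neg fun v hv => ?_
    have h1 := hconc M.θ₀ (Metric.mem_ball_self hr) v
    have h2 : 0 < c * ‖v‖ ^ 2 := by positivity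
    rw [matVec_neg, inner_neg_right]
    linarith
  have hnonpos := hneg hpos
  set x := M.mle N ω with hxdef
  set y := M.est N lam ω with hydef
  have hmono := inner_sub_le_of_hasFDerivAt hconv hr hball (x := x) (y := y) (c := c)
    (by rwa [Metric.mem_ball, dist_eq_norm]) hmax1.1
    (fun θ hθ => (hasFDerivAt_avgScore hsm N hθ).1)
    (fun θ hθ v => by
      rw [(hasFDerivAt_avgScore hsm N (interior_subset hθ)).2]
      exact hnonpos θ hθ v)
    (fun θ hθ v => by
      rw [(hasFDerivAt_avgScore hsm N (hball hθ)).2]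
      exact hconc θ hθ v)
  have hsx : M.avgScore N ω x = 0 := by
    change M.avgScore N ω (M.est N 0 ω) = 0
    simpa using hfoc0
  -- By the first-order conditions the score vanishes at the MLE and equals the penalty gradient at
  -- the ridge estimator, so monotonicity becomes an inequality with a factor `lam`.
  rw [hsx, sub_zero, sub_eq_zero.1 hfoc1, real_inner_smul_left] at hmono
  by_cases hxy : ‖y - x‖ = 0
  · rw [hxy]; positivity
  have hdist : 0 < ‖y - x‖ := lt_of_le_of_ne (norm_nonneg _) (Ne.symm hxy)
  have hyt : ‖y - M.target‖ ≤ D := by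
    calc ‖y - M.target‖ ≤ ‖y - M.θ₀‖ + ‖M.θ₀ - M.target‖ := norm_sub_le_norm_sub_add_norm_sub _ _ _
      _ ≤ D := by
        rw [hD]
        gcongr
        exact hcr.trans (by gcongr)
  have hlamN : lam ≤ κ / N := by
    rw [Real.norm_of_nonneg (hM.lamBar_nonneg N), norm_inv, Real.norm_natCast] at hbar
    exact hlam.2.trans (hbar.trans_eq (by ring))
  have hinner : -(F * D * ‖y - x‖) ≤ inner ℝ (matVec M.gram (y - M.target)) (y - x) := by
    have h1 := (abs_le.1 (abs_real_inner_le_norm (matVec M.gram (y - M.target)) (y - x))).1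
    have h2 : ‖matVec M.gram (y - M.target)‖ * ‖y - x‖ ≤ F * D * ‖y - x‖ := by
      gcongr
      exact (norm_matVec_le _ _).trans (by gcongr)
    linarith
  have hmin : min ‖y - x‖ (r / 2) ≤ d / N := by
    have h1 : c * (‖y - x‖ * min ‖y - x‖ (r / 2)) ≤ 2 * lam * (F * D * ‖y - x‖) := by
      have := mul_le_mul_of_nonneg_left hinner (by linarith [hlam.1] : 0 ≤ 2 * lam)
      linarith
    have h2 : c * min ‖y - x‖ (r / 2) ≤ 2 * lam * (F * D) := by
      refine le_of_mul_le_mul_right ?_ hdist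
      linarith
    have h3 : 2 * lam * (F * D) ≤ 2 * (κ / N) * (F * D) := by gcongr
    have h4 : d / N = 2 * (κ / N) * (F * D) / c := by rw [hd]; field_simp
    rw [h4, le_div_iff₀ hc]
    linarith
  rcases min_le_iff.1 hmin with h | h
  · exact h
  -- For large `N` the minimum cannot be `r / 2`, which exceeds `d / N`.
  · exact absurd h (not_le.2 hsmall)

/-- The second moment of the scaled error of the MLE does not vanish in the limit. -/
lemma Standing.exists_le_integral_sq (hM : M.Standing) (hp : 0 < p) (hlocal : M.LocalRegularity)
    (hmle : M.MLEMoments 16) (hreg : M.MLERegularity) (htrue : M.TrueValueMoments 8) :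
    ∃ c > 0, ∀ᶠ N : ℕ in atTop, c ≤ N * ∫ ω, ‖M.mle N ω - M.θ₀‖ ^ 2 ∂M.P := by
  have := hM.prob
  let a : Fin p := ⟨0, hp⟩
  set s := ∫ z, M.score z M.θ₀ a ^ 2 ∂M.law with hs
  -- One coordinate of the score suffices for a lower bound; its variance is a diagonal entry of a
  -- positive definite matrix.
  have hs0 : 0 < s := by
    have := hreg.posDef.diag_pos (i := a)
    simpa [scoreCov, hs, sq] using this
  have hmean : ∫ z, M.score z M.θ₀ a ∂M.law = 0 := by
    have h := (EuclideanSpace.proj (𝕜 := ℝ) a).integral_comp_comm hlocal.score_integrable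
    rw [hM.score_mean, map_zero] at h
    exact h
  have hmem := htrue.memLp_score hM a
  obtain ⟨K, hK, hmom⟩ := hM.integral_sum_obs hmem hmean
  obtain ⟨C, -, hC⟩ := hmle.exists_bound hM
  set F := frobNorm M.meanHess + 1 with hF
  have hF0 : 0 < F := by linarith [frobNorm_nonneg M.meanHess]
  set τ := s / (4 * K) with hτ
  have hτ0 : 0 < τ := by positivity
  set ε := √(s / (8 * F ^ 2)) with hε
  have hε0 : 0 < ε := by positivity
  have hεsq : ε ^ 2 = s / (8 * F ^ 2) := Real.sq_sqrt (by positivity)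
  have hunit : IsUnit M.meanHess.det := by
    have h1 : M.meanHess = -M.scoreCov := by rw [hreg.information, neg_neg]
    rw [h1, Matrix.det_neg]
    exact (isUnit_one.neg.pow _).mul (isUnit_iff_ne_zero.2 hreg.posDef.det_pos.ne')
  have hlin := (tendstoInMeasure_iff_norm.1 hreg.linear) ε hε0
  simp only [sub_zero] at hlin
  have hlin' := hlin.eventually (gt_mem_nhds (ENNReal.ofReal_pos.2 (by positivity : 0 < s * τ / 2)))
  refine ⟨s / (8 * F ^ 2), by positivity, ?_⟩
  filter_upwards [hlin', hC, eventually_ge_atTop 1] with N hD hCN hN1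
  have hN0 : (0 : ℝ) < N := by exact_mod_cast hN1
  set T : Ω → EuclideanSpace ℝ (Fin p) := fun ω => √(N : ℝ) • (M.mle N ω - M.θ₀) with hT
  set W : Ω → EuclideanSpace ℝ (Fin p) := fun ω =>
    (√(N : ℝ))⁻¹ • ∑ i ∈ Finset.range N, M.score (M.Z i ω) M.θ₀ with hW
  set S : Ω → ℝ := fun ω => ∑ i ∈ Finset.range N, M.score (M.Z i ω) M.θ₀ a with hS
  set D := toMeasurable M.P {ω | ε ≤ ‖T ω + matVec (M.Q 0) (W ω)‖} with hDdef
  have hDm : MeasurableSet D := measurableSet_toMeasurable _ _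
  have hDP : M.P.real D ≤ s * τ / 2 := by
    refine ENNReal.toReal_le_of_le_ofReal (by positivity) ?_
    rw [hDdef, measure_toMeasurable]
    exact hD.le
  have hsqrt : √(N : ℝ) ^ 2 = N := Real.sq_sqrt hN0.le
  have hTsq : ∀ ω, ‖T ω‖ ^ 2 = N * ‖M.mle N ω - M.θ₀‖ ^ 2 := fun ω => by
    rw [hT, norm_smul, mul_pow, Real.norm_of_nonneg (Real.sqrt_nonneg _), hsqrt]
  have hWa : ∀ ω, W ω a = (√(N : ℝ))⁻¹ * S ω := fun ω => by
    simp [hW, hS, Finset.sum_apply]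
  have hWsq : ∀ ω, W ω a ^ 2 = (N : ℝ)⁻¹ * S ω ^ 2 := fun ω => by
    rw [hWa, mul_pow, inv_pow, hsqrt]
  have hWfour : ∀ ω, W ω a ^ 4 = ((N : ℝ) ^ 2)⁻¹ * S ω ^ 4 := fun ω => by
    rw [show W ω a ^ 4 = (W ω a ^ 2) ^ 2 by ring, hWsq]; ring
  -- A lower bound on the linear term `Q W` is needed: multiplying by `E(H_1)` inverts `Q`, which
  -- costs a factor `F`.
  have hWle : ∀ ω, |W ω a| ≤ F * ‖matVec (M.Q 0) (W ω)‖ := fun ω => by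
    have h1 : W ω = matVec M.meanHess (matVec (M.Q 0) (W ω)) := by
      rw [← matVec_mul, Q, mul_zero, zero_smul, sub_zero, Matrix.mul_nonsing_inv _ hunit,
        matVec_one]
    calc |W ω a| ≤ ‖W ω‖ := PiLp.norm_apply_le (W ω) a
      _ ≤ frobNorm M.meanHess * ‖matVec (M.Q 0) (W ω)‖ := by
        conv_lhs => rw [h1]
        exact norm_matVec_le _ _
      _ ≤ _ := by gcongr; linarith
  -- Off `D` the linearisation error is below `ε`. On `D` the square is traded for a small multiple
  -- of the fourth power plus a constant. After integration the choices of `ε`, `τ` and the bound on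
  -- `P(D)` give errors `s / 4`, `s / 4` and `s / 8`, less than the total variance `s`.
  have hpt : ∀ ω, W ω a ^ 2 ≤ 2 * F ^ 2 * (N * ‖M.mle N ω - M.θ₀‖ ^ 2) + s / 4 + τ * W ω a ^ 4
      + 1 / (4 * τ) * D.indicator (fun _ => (1 : ℝ)) ω := by
    intro ω
    rw [← hTsq]
    by_cases hω : ω ∈ D
    · rw [indicator_of_mem hω]
      have h1 : τ * W ω a ^ 4 + 1 / (4 * τ) * 1 - W ω a ^ 2 =
          (2 * τ * W ω a ^ 2 - 1) ^ 2 / (4 * τ) := by field_simp; ring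
      have h2 : 0 ≤ (2 * τ * W ω a ^ 2 - 1) ^ 2 / (4 * τ) := by positivity
      have h3 : 0 ≤ 2 * F ^ 2 * ‖T ω‖ ^ 2 + s / 4 := by positivity
      linarith
    · rw [indicator_of_notMem hω, mul_zero, add_zero]
      have h1 : ‖T ω + matVec (M.Q 0) (W ω)‖ < ε := by
        by_contra! h
        exact hω (subset_toMeasurable _ _ h)
      have h2 : ‖matVec (M.Q 0) (W ω)‖ ≤ ‖T ω‖ + ε := by
        have := norm_sub_le (T ω + matVec (M.Q 0) (W ω)) (T ω)
        rw [add_sub_cancel_left] at this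
        linarith
      have h3 : W ω a ^ 2 ≤ (F * (‖T ω‖ + ε)) ^ 2 := by
        rw [← sq_abs]
        exact pow_le_pow_left₀ (abs_nonneg _) ((hWle ω).trans (by gcongr)) 2
      have h4 : 2 * F ^ 2 * ε ^ 2 = s / 4 := by rw [hεsq]; field_simp; norm_num
      have h5 : 0 ≤ τ * W ω a ^ 4 := by positivity
      have h6 : 0 ≤ F ^ 2 * (‖T ω‖ - ε) ^ 2 := by positivity
      nlinarith
  have hSmem := hM.memLp_sum_obs hmem N
  have hS2 : Integrable (fun ω => S ω ^ 2) M.P :=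
    MemLp.integrable_pow_of_le (n := 4) (by exact_mod_cast hSmem) (by norm_num)
  have hS4 : Integrable (fun ω => S ω ^ 4) M.P :=
    MemLp.integrable_pow_of_le (n := 4) (by exact_mod_cast hSmem) le_rfl
  have hW2 : Integrable (fun ω => W ω a ^ 2) M.P := by
    simp_rw [hWsq]; exact hS2.const_mul _
  have hW4 : Integrable (fun ω => W ω a ^ 4) M.P := by
    simp_rw [hWfour]; exact hS4.const_mul _
  have hW2val : ∫ ω, W ω a ^ 2 ∂M.P = s := by
    simp_rw [hWsq]
    rw [integral_const_mul, (hmom N).1]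
    field_simp
    exact hs.symm
  have hW4val : ∫ ω, W ω a ^ 4 ∂M.P ≤ K := by
    simp_rw [hWfour]
    rw [integral_const_mul, inv_mul_le_iff₀ (by positivity)]
    linarith [(hmom N).2]
  have hDint : Integrable (D.indicator fun _ => (1 : ℝ)) M.P := (integrable_const 1).indicator hDm
  have hDval : ∫ ω, D.indicator (fun _ => (1 : ℝ)) ω ∂M.P = M.P.real D := by
    rw [integral_indicator hDm]; simp
  have i1 : Integrable (fun ω => 2 * F ^ 2 * (N * ‖M.mle N ω - M.θ₀‖ ^ 2) + s / 4) M.P :=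
    ((hCN.1.const_mul _).const_mul _).add (integrable_const _)
  have i2 := i1.fun_add (hW4.const_mul τ)
  have i3 := i2.fun_add (hDint.const_mul (1 / (4 * τ)))
  have hmain := integral_mono hW2 i3 hpt
  rw [hW2val, integral_add i2 (hDint.const_mul _), integral_add i1 (hW4.const_mul _),
    integral_add ((hCN.1.const_mul _).const_mul _) (integrable_const _)] at hmain
  simp only [integral_const_mul, hDval, integral_const, probReal_univ, one_smul] at hmain
  have e1 : τ * ∫ ω, W ω a ^ 4 ∂M.P ≤ s / 4 := by
    calc _ ≤ τ * K := by gcongr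
      _ = s / 4 := by rw [hτ]; field_simp
  have e2 : 1 / (4 * τ) * M.P.real D ≤ s / 8 := by
    calc _ ≤ 1 / (4 * τ) * (s * τ / 2) := by gcongr
      _ = s / 8 := by field_simp; norm_num
  rw [div_le_iff₀ (by positivity)]
  nlinarith

end RidgeModel

/-! ### Uniform comparison of risks and the conclusion -/

namespace RidgeModel

variable {Ω 𝒵 : Type*} [MeasurableSpace Ω] [MeasurableSpace 𝒵] {p : ℕ} {M : RidgeModel Ω 𝒵 p}

/-- Square integrability justifies exchanging trace and integral; without it the entries could take
the default value zero. -/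
lemma risk_eq_integral {N : ℕ} {lam : ℝ} (h : MemLp (fun ω => M.est N lam ω - M.θ₀) 2 M.P) :
    M.risk N lam = ∫ ω, ‖M.est N lam ω - M.θ₀‖ ^ 2 ∂M.P := by
  have hcoord : ∀ a, Integrable (fun ω => (M.est N lam ω - M.θ₀) a * (M.est N lam ω - M.θ₀) a)
      M.P := fun a => by
    have : MemLp (fun ω => (M.est N lam ω - M.θ₀) a) 2 M.P :=
      (EuclideanSpace.proj (𝕜 := ℝ) a).comp_memLp' h
    simpa only [sq] using this.integrable_sq
  simp_rw [EuclideanSpace.real_norm_sq_eq, sq]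
  rw [integral_finsetSum _ fun a _ => hcoord a]
  simp [risk, mse, Matrix.trace]

/-- All ridge estimators have the risk of the MLE up to an error of smaller order than `1 / N`. -/
lemma Standing.exists_risk_bound (hM : M.Standing) (hconv : Convex ℝ M.Θ)
    (hlocal : M.LocalRegularity) (hlip : M.LipschitzDerivatives 8) (hmle : M.MLEMoments 16)
    (hreg : M.MLERegularity) (htrue : M.TrueValueMoments 8) (hunif : M.UniformMoments 16) :
    ∃ K : ℝ, ∀ᶠ N : ℕ in atTop, ∀ lam ∈ Icc 0 (M.lamBar N),
      MemLp (fun ω => M.est N lam ω - M.θ₀) 2 M.P ∧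
      N * |M.risk N lam - ∫ ω, ‖M.mle N ω - M.θ₀‖ ^ 2 ∂M.P| ≤ K / √(N : ℝ) := by
  have := hM.prob
  obtain ⟨C, -, hC⟩ := hmle.exists_bound hM
  obtain ⟨c, -, hcrude⟩ := hM.exists_norm_est_sub_le
  obtain ⟨b, d, hb, hd, hev⟩ := hM.exists_close_event hconv hlocal hlip hmle hreg htrue hunif
  refine ⟨d * (1 + C) + d ^ 2 + 2 * c ^ 2 * b + (2 * c ^ 2 + 1) * (b + C), ?_⟩
  filter_upwards [hC, hcrude, hev, eventually_ge_atTop 1] with N hC hcrude hev hN1 lam hlam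
  obtain ⟨B, hB, hclose⟩ := hev
  have hmeas := hM.aestronglyMeasurable_est hlam
  obtain ⟨hint, hbound⟩ := abs_integral_sq_sub_le hmeas (n := N) (by exact_mod_cast hN1) hd hb hC.1
    hC.2.1 hC.2.2.1 hC.2.2.2 (hcrude lam hlam) hB (by simpa using hclose lam hlam)
  have hmem : MemLp (fun ω => M.est N lam ω - M.θ₀) 2 M.P :=
    (memLp_two_iff_integrable_sq_norm hmeas).2 hint
  exact ⟨hmem, by rwa [risk_eq_integral hmem]⟩

end RidgeModel

/-- All values lie within `η / n` of `m ≥ c / n`, so their spread is at most `2 η / n`, while `η ≤ c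
/ 2` keeps the infimum above `c / (2 n)`. -/
lemma abs_div_sInf_sub_one_le {A : Set ℝ} {x m c η : ℝ} (hx : x ∈ A) (hη : η ≤ c / 2) (hc : 0 < c)
    {n : ℝ} (hn : 0 < n) (hm : c ≤ n * m) (h : ∀ y ∈ A, n * |y - m| ≤ η) :
    0 < sInf A ∧ |x / sInf A - 1| ≤ 4 * η / c := by
  have hlow : ∀ y ∈ A, m - η / n ≤ y := fun y hy => by
    have h1 : |y - m| ≤ η / n := by rw [le_div_iff₀ hn]; linarith [h y hy]
    linarith [(abs_le.1 h1).1]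
  have hI : m - η / n ≤ sInf A := le_csInf ⟨x, hx⟩ hlow
  have hIx : sInf A ≤ x := csInf_le ⟨_, hlow⟩ hx
  have hcn : c / (2 * n) ≤ sInf A := by
    refine le_trans ?_ hI
    have h1 : c / n ≤ m := by rw [div_le_iff₀ hn]; linarith
    have h2 : η / n ≤ c / 2 / n := by gcongr
    have h3 : c / (2 * n) = c / n - c / 2 / n := by field_simp; ring
    linarith
  have hpos : 0 < sInf A := lt_of_lt_of_le (by positivity) hcn
  refine ⟨hpos, ?_⟩
  have hxm : |x - m| ≤ η / n := by rw [le_div_iff₀ hn]; linarith [h x hx]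
  have hη0 : 0 ≤ η := le_trans (by positivity) (h x hx)
  have h1 : x / sInf A - 1 = (x - sInf A) / sInf A := by field_simp
  rw [h1, abs_of_nonneg (div_nonneg (by linarith) hpos.le), div_le_iff₀ hpos]
  calc x - sInf A ≤ 2 * (η / n) := by linarith [(abs_le.1 hxm).2]
    _ = 4 * η / c * (c / (2 * n)) := by field_simp; ring
    _ ≤ 4 * η / c * sInf A := by gcongr

theorem theorem3 {Ω 𝒵 : Type*} [MeasurableSpace Ω] [MeasurableSpace 𝒵] {p : ℕ} (hp : 0 < p)
    (M : RidgeModel Ω 𝒵 p) (hM : M.Standing) (hconv : Convex ℝ M.Θ)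
    (hrate : M.RidgeRate)
    (hlocal : M.LocalRegularity)
    (hinv : M.InverseBounds)
    (hlip : M.LipschitzDerivatives 8)
    (hmle : M.MLEMoments 16)
    (hreg : M.MLERegularity)
    (htrue : M.TrueValueMoments 8)
    (hunif : M.UniformMoments 16)
    (lamHat : ℕ → Ω → ℝ) (hsel : M.IsSelector lamHat) :
    (∀ᶠ N in atTop,
      (∀ lam ∈ M.cand N, MemLp (fun ω => M.est N lam ω - M.θ₀) 2 M.P) ∧
      0 < sInf (M.risk N '' M.cand N)) ∧
    TendstoInMeasure M.P
      (fun N ω => M.risk N (lamHat N ω) / sInf (M.risk N '' M.cand N))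
      atTop (fun _ => (1 : ℝ)) := by
  obtain ⟨K, hK⟩ := hM.exists_risk_bound hconv hlocal hlip hmle hreg htrue hunif
  obtain ⟨c, hc, hlow⟩ := hM.exists_le_integral_sq hp hlocal hmle hreg htrue
  have hlim : Tendsto (fun N : ℕ => K / √(N : ℝ)) atTop (𝓝 0) :=
    (tendsto_const_nhds (x := K)).div_atTop
      (Real.tendsto_sqrt_atTop.comp tendsto_natCast_atTop_atTop)
  have key : ∀ᶠ N : ℕ in atTop, ∀ lam ∈ M.cand N, 0 < sInf (M.risk N '' M.cand N) ∧
      |M.risk N lam / sInf (M.risk N '' M.cand N) - 1| ≤ 4 * (K / √(N : ℝ)) / c := by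
    filter_upwards [hK, hlow, hlim.eventually (ge_mem_nhds (by positivity : 0 < c / 2)),
      eventually_ge_atTop 1] with N hKN hlowN hη hN1 lam hlam
    refine abs_div_sInf_sub_one_le (mem_image_of_mem _ hlam) hη hc
      (by exact_mod_cast hN1 : (0 : ℝ) < N) hlowN ?_
    rintro _ ⟨lam', hlam', rfl⟩
    exact (hKN lam' (hM.cand_subset N hlam')).2
  refine ⟨?_, ?_⟩
  · filter_upwards [hK, key] with N hKN hkey
    obtain ⟨lam, hlam⟩ := hM.cand_nonempty N
    exact ⟨fun lam hlam => (hKN lam (hM.cand_subset N hlam)).1, (hkey lam hlam).1⟩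
  · rw [tendstoInMeasure_iff_norm]
    intro ε hε
    have hlim' : Tendsto (fun N : ℕ => 4 * (K / √(N : ℝ)) / c) atTop (𝓝 0) := by
      simpa using (hlim.const_mul 4).div_const c
    -- The bound on the ratio is deterministic and uniform over candidates, so the deviation
    -- probability is eventually exactly zero.
    refine tendsto_const_nhds.congr' ?_
    filter_upwards [key, hsel, hlim'.eventually (gt_mem_nhds hε)] with N hkey hselN hsmall
    refine (measure_eq_zero_iff_ae_notMem.2 ?_).symm
    filter_upwards [hselN] with ω hω
    exact not_le.2 (((hkey _ hω.1).2).trans_lt hsmall)
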